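/- Let $(W,d)$ be a Hilbert complex: real Hilbert spaces $W^k$ ($k\in\mathbb Z$; $W^k$ may vanish for $k<0$ and for large $k$) and closed densely defined operators $d^k$ from $W^k$ to $W^{k+1}$ with domain $V^k$, such that $d^kV^k\subset V^{k+1}$ and $d^{k+1}d^k=0$. Let $\|\cdot\|$, $\langle\cdot,\cdot\rangle$ denote the norm and inner product of $W^k$, put $\|v\|_V^2=\|v\|^2+\|dv\|^2$, and let $V_k^*\subset W^k$ be the domain of the adjoint $d_k^*$ of $d^{k-1}$. Suppose that $(W,d)$ is closed (every $d^k$ has closed range) and has the compactness property: for every $k$, $V^k\cap V_k^*$ is dense in $W^k$, and its inclusion into $W^k$ is compact when it carries the norm $(2\|v\|^2+\|dv\|^2+\|d^*v\|^2)^{1/2}$. Let $S\subset(0,\infty)$ be a set of parameters, and for $h\in S$ let $V_h^k\subset V^k$ ($k\in\mathbb Z$) be finite-dimensional subspaces with $dV_h^k\subset V_h^{k+1}$. Suppose that * the subspaces are approximating: $\lim_{h\to0}\inf_{v\in V_h^k}\|u-v\|_V=0$ for all $k$ and all $u\in V^k$; * there are $W$-bounded cochain projections, uniformly in $h$: linear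 maps $\pi_h^k:V^k\to V_h^k$ that are the identity on $V_h^k$ and satisfy $d\pi_h^k=\pi_h^{k+1}d$, and for each $k$ a constant $c$ such that $\|\pi_h^kv\|\le c\|v\|$ for all $h\in S$, $v\in V^k$. Fix $k$. Let $\mathfrak H^k=\{q\in V^k: dq=0,\ q\perp dV^{k-1}\}$ and $\mathfrak H_h^k=\{q\in V_h^k: dq=0,\ q\perp dV_h^{k-1}\}$, with orthogonality in $W^k$. The continuous eigenvalue problem is to find $\lambda\in\mathbb R$ and $0\ne u\in V^k$ for which there exist $\sigma\in V^{k-1}$ and $p\in\mathfrak H^k$ with $$\begin{aligned}\langle\sigma,\tau\rangle-\langle d\tau,u\rangle&=0,&&\tau\in V^{k-1},\\ \langle d\sigma,v\rangle+\langle du,dv\rangle+\langle v,p\rangle&=\lambda\langle u,v\rangle,&&v\in V^k,\\ \langle u,q\rangle&=0,&&q\in\mathfrak H^k;\end{aligned}$$ the discrete problem is obtained by replacing $V^{k-1},V^k,\mathfrak H^k$ by $V_h^{k-1},V_h^k,\mathfrak H_h^k$. Then the eigenvalues of the continuous problem can be listed in nondecreasing order, repeated according to multiplicity, as a finite or infinite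 sequence $\lambda_1\le\lambda_2\le\cdots$ with corresponding $W^k$-orthonormal eigenvectors $v_1,v_2,\dots$ spanning the eigenspaces; similarly, for each $h\in S$, those of the discrete problem can be listed as $\lambda_{1,h}\le\lambda_{2,h}\le\cdots$ with eigenvectors $v_{1,h},v_{2,h},\dots$. The discrete problems converge to the continuous one in the following sense. Let $j\ge1$ be such that there are at least $j$ distinct eigenvalues $\lambda_i$. Then the number $m(j)$ of indices $i$ for which $\lambda_i$ is at most the $j$-th distinct eigenvalue is finite, and for every $\epsilon>0$ there is $h_0>0$ such that, for all $h\in S$ with $h\le h_0$ and every choice of the $v_{i,h}$, there are at least $m(j)$ discrete eigenvalues (counted with multiplicity) and $$\max_{1\le i\le m(j)}|\lambda_i-\lambda_{i,h}|\le\epsilon,\qquad \operatorname{gap}\bigl(\operatorname{span}\{v_1,\dots,v_{m(j)}\},\operatorname{span}\{v_{1,h},\dots,v_{m(j),h}\}\bigr)\le\epsilon .$$ Here $$\operatorname{gap}(E,F)=\max\Bigl(\sup_{u\in E,\,|u|=1}\inf_{v\in F}|u-v|,\ \sup_{v\in F,\,|v|=1}\inf_{u\in E}|u-v|\Bigr),$$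 and the bound holds both with $|\cdot|=\|\cdot\|$ and with $|\cdot|=\|\cdot\|_V$. -/

import Mathlib

open scoped InnerProductSpace

noncomputable section

/-- A Hilbert complex: real Hilbert spaces `W k`, `k : ℤ`, and closed densely defined operators
`d k` from `W k` to `W (k + 1)`, the range of `d k` being contained in the domain of `d (k + 1)`,
with `d (k + 1) ∘ d k = 0`. Nonnegative and finite complexes are those for which `W k` is the zero
space when `k` is negative or large. -/
structure HilbertComplex (W : ℤ → Type*) [∀ k, NormedAddCommGroup (W k)]
    [∀ k, InnerProductSpace ℝ (W k)] [∀ k, CompleteSpace (W k)] where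
  d : ∀ k : ℤ, W k →ₗ.[ℝ] W (k + 1)
  dense_domain : ∀ k, Dense ((d k).domain : Set (W k))
  closed : ∀ k, (d k).IsClosed
  d_mem : ∀ k (x : (d k).domain), d k x ∈ (d (k + 1)).domain
  d_d : ∀ k (x : (d k).domain), d (k + 1) ⟨d k x, d_mem k x⟩ = 0

namespace HilbertComplex

variable {W : ℤ → Type*} [∀ k, NormedAddCommGroup (W k)] [∀ k, InnerProductSpace ℝ (W k)]
  [∀ k, CompleteSpace (W k)]

/-- The spaces of the domain complex. The norm that Lean puts on this submodule is that of `W k`;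
the graph norm is `vNorm` below. -/
abbrev V (C : HilbertComplex W) (k : ℤ) : Submodule ℝ (W k) := (C.d k).domain

/-- The differential of the domain complex, from `V k` to `V (k + 1)`. -/
def dV (C : HilbertComplex W) (k : ℤ) : C.V k →ₗ[ℝ] C.V (k + 1) :=
  (C.d k).toFun.codRestrict (C.V (k + 1)) (C.d_mem k)

/-- The graph norm on `V k`. -/
def vNorm (C : HilbertComplex W) (k : ℤ) (u : C.V k) : ℝ :=
  Real.sqrt (‖(u : W k)‖ ^ 2 + ‖(C.dV k u : W (k + 1))‖ ^ 2)

/-- The complex is closed: every differential has closed range. -/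
def IsClosedComplex (C : HilbertComplex W) : Prop :=
  ∀ k, IsClosed (Set.range fun x : C.V k => C.d k x)

/-- The domain of the adjoint of `d k`; this is the space `V*` of the dual complex in
degree `k + 1`. -/
abbrev Vstar (C : HilbertComplex W) (k : ℤ) : Submodule ℝ (W (k + 1)) :=
  (C.d k).adjoint.domain

/-- The unit ball of `V ∩ V*` in degree `k + 1`, for the norm whose square is
`‖v‖_V ^ 2 + ‖v‖_{V*} ^ 2`, as a subset of `W (k + 1)`. -/
def intersectionBall (C : HilbertComplex W) (k : ℤ) : Set (W (k + 1)) :=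
  {v | ∃ (hv : v ∈ C.V (k + 1)) (hv' : v ∈ C.Vstar k),
    (‖v‖ ^ 2 + ‖C.d (k + 1) ⟨v, hv⟩‖ ^ 2) + (‖v‖ ^ 2 + ‖(C.d k).adjoint ⟨v, hv'⟩‖ ^ 2) ≤ 1}

/-- The compactness property: in every degree (every integer is of the form `k + 1`) `V ∩ V*` is
dense in `W` and its inclusion into `W` is compact, i.e. its unit ball is relatively compact. -/
def CompactnessProperty (C : HilbertComplex W) : Prop :=
  ∀ k, Dense ((C.V (k + 1) ⊓ C.Vstar k : Submodule ℝ (W (k + 1))) : Set (W (k + 1))) ∧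
    IsCompact (closure (C.intersectionBall k))

/-- A subcomplex of the domain complex. -/
structure Subcomplex (C : HilbertComplex W) where
  space : ∀ k, Submodule ℝ (C.V k)
  map_mem : ∀ k, ∀ v ∈ space k, C.dV k v ∈ space (k + 1)

/-- The domain complex as a subcomplex of itself. -/
def whole (C : HilbertComplex W) : C.Subcomplex where
  space _ := ⊤
  map_mem _ _ _ := Submodule.mem_top

namespace Subcomplex

variable {C : HilbertComplex W}

/-- The harmonic forms of a subcomplex in degree `k + 1`: the cocycles of the subcomplex that are
orthogonal (in `W`) to its coboundaries. -/
def harmonic (U : C.Subcomplex) (k : ℤ) : Set (C.V (k + 1)) :=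
  {q | q ∈ U.space (k + 1) ∧ C.dV (k + 1) q = 0 ∧
    ∀ τ ∈ U.space k, ⟪(C.dV k τ : W (k + 1)), (q : W (k + 1))⟫_ℝ = 0}

/-- `(lam, u)` is an eigenvalue/eigenvector pair, in degree `k + 1`, of the mixed formulation of
the Hodge Laplacian posed on the subcomplex `U`. For `U = C.whole` this is the continuous problem,
for a finite-dimensional `U` it is its Galerkin discretization. -/
def IsEigenpair (U : C.Subcomplex) (k : ℤ) (lam : ℝ) (u : C.V (k + 1)) : Prop :=
  u ∈ U.space (k + 1) ∧ u ≠ 0 ∧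
  ∃ σ ∈ U.space k, ∃ p ∈ U.harmonic k,
    (∀ τ ∈ U.space k,
      ⟪(σ : W k), (τ : W k)⟫_ℝ - ⟪(C.dV k τ : W (k + 1)), (u : W (k + 1))⟫_ℝ = 0) ∧
    (∀ v ∈ U.space (k + 1),
      ⟪(C.dV k σ : W (k + 1)), (v : W (k + 1))⟫_ℝ
        + ⟪(C.dV (k + 1) u : W (k + 1 + 1)), (C.dV (k + 1) v : W (k + 1 + 1))⟫_ℝ
        + ⟪(v : W (k + 1)), (p : W (k + 1))⟫_ℝ
        = lam * ⟪(u : W (k + 1)), (v : W (k + 1))⟫_ℝ) ∧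
    (∀ q ∈ U.harmonic k, ⟪(u : W (k + 1)), (q : W (k + 1))⟫_ℝ = 0)

/-- `ev i`, `i < N`, are the eigenvalues of the problem on `U` in degree `k + 1`, in nondecreasing
order and repeated according to multiplicity, and `v i`, `i < N`, is a corresponding
`W`-orthonormal family of eigenvectors (`N = ⊤` if there are infinitely many). The values of `ev`
and `v` at `i ≥ N` are irrelevant. -/
structure IsEigensystem (U : C.Subcomplex) (k : ℤ) (N : ℕ∞) (ev : ℕ → ℝ)
    (v : ℕ → C.V (k + 1)) : Prop where
  isEigenpair : ∀ i : ℕ, (i : ℕ∞) < N → U.IsEigenpair k (ev i) (v i)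
  mono : ∀ i j : ℕ, i ≤ j → (j : ℕ∞) < N → ev i ≤ ev j
  orthonormal : Orthonormal ℝ fun i : {i : ℕ // (i : ℕ∞) < N} => (v i : W (k + 1))
  multiplicity : ∀ (lam : ℝ) (u : C.V (k + 1)), U.IsEigenpair k lam u →
    u ∈ Submodule.span ℝ (v '' {i : ℕ | (i : ℕ∞) < N ∧ ev i = lam})

end Subcomplex

/-- A family of subcomplexes, parametrized by `h ∈ S`, is approximating: for every `k` and
`u ∈ V k`, the `V`-distance of `u` to the subspace tends to zero with `h`. -/
def Approximating (C : HilbertComplex W) {S : Set ℝ} (U : S → C.Subcomplex) : Prop :=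
  ∀ k (u : C.V k), ∀ ε > (0 : ℝ), ∃ h₀ > (0 : ℝ), ∀ h : S, (h : ℝ) ≤ h₀ →
    ∃ v ∈ (U h).space k, C.vNorm k (u - v) < ε

/-- The family admits cochain projections onto the subcomplexes, bounded in the norm of `W k`
uniformly in `h`. -/
def HasUniformlyBoundedCochainProjections (C : HilbertComplex W) {S : Set ℝ}
    (U : S → C.Subcomplex) : Prop :=
  ∃ π : S → ∀ k, C.V k →ₗ[ℝ] C.V k,
    (∀ h k v, π h k v ∈ (U h).space k) ∧
    (∀ h k, ∀ v ∈ (U h).space k, π h k v = v) ∧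
    (∀ h k v, C.dV k (π h k v) = π h (k + 1) (C.dV k v)) ∧
    (∀ k, ∃ c : ℝ, ∀ h v, ‖(π h k v : W k)‖ ≤ c * ‖(v : W k)‖)

end HilbertComplex

/-- The gap between two subspaces, with respect to the norm `nrm`. -/
def subspaceGap {X : Type*} [AddCommGroup X] [Module ℝ X] (nrm : X → ℝ)
    (E F : Submodule ℝ X) : ℝ :=
  max (sSup {r | ∃ u ∈ E, nrm u = 1 ∧ r = sInf {s | ∃ v ∈ F, s = nrm (u - v)}})
    (sSup {r | ∃ v ∈ F, nrm v = 1 ∧ r = sInf {s | ∃ u ∈ E, s = nrm (u - v)}})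

/-- `μ` is the `j`-th distinct value (counted from `1`, in increasing order) among `ev i`,
`i < N`. -/
def IsNthDistinct (N : ℕ∞) (ev : ℕ → ℝ) (j : ℕ) (μ : ℝ) : Prop :=
  μ ∈ ev '' {i : ℕ | (i : ℕ∞) < N} ∧
    (ev '' {i : ℕ | (i : ℕ∞) < N} ∩ Set.Iic μ).encard = j

namespace HilbertComplex

variable {W : ℤ → Type*} [∀ k, NormedAddCommGroup (W k)] [∀ k, InnerProductSpace ℝ (W k)]
  [∀ k, CompleteSpace (W k)]

/-- The discrete eigenvalue problems in degree `k + 1` converge to the continuous one. The first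
two clauses say that all problems have eigensystems. In the third, `m` is the number of continuous
eigenvalues (with multiplicity) up to the `j`-th distinct one; for small `h` there are at least `m`
discrete eigenvalues, the first `m` of them are close to the continuous ones, and, whatever
eigenbases are chosen, the spans of the first `m` eigenvectors are close in the sense of the gap,
both in the Hilbert space `W` and in the Hilbert space `V`. -/
def EigenvalueProblemsConverge (C : HilbertComplex W) {S : Set ℝ} (U : S → C.Subcomplex)
    (k : ℤ) : Prop :=
  (∃ N ev v, C.whole.IsEigensystem k N ev v) ∧
  (∀ h, ∃ N ev v, (U h).IsEigensystem k N ev v) ∧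
  ∀ N ev v, C.whole.IsEigensystem k N ev v →
    ∀ (j : ℕ) (μ : ℝ), IsNthDistinct N ev j μ →
      ∃ m : ℕ, {i : ℕ | (i : ℕ∞) < N ∧ ev i ≤ μ}.encard = m ∧
        ∀ ε > (0 : ℝ), ∃ h₀ > (0 : ℝ), ∀ h : S, (h : ℝ) ≤ h₀ →
          ∀ Nh evh vh, (U h).IsEigensystem k Nh evh vh →
            (m : ℕ∞) ≤ Nh ∧
            (∀ i < m, |ev i - evh i| ≤ ε) ∧
            subspaceGap (fun u : C.V (k + 1) => ‖(u : W (k + 1))‖)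
              (Submodule.span ℝ (v '' Set.Iio m)) (Submodule.span ℝ (vh '' Set.Iio m)) ≤ ε ∧
            subspaceGap (C.vNorm (k + 1))
              (Submodule.span ℝ (v '' Set.Iio m)) (Submodule.span ℝ (vh '' Set.Iio m)) ≤ ε

end HilbertComplex

end

open Filter Topology

/-! The mixed problem, posed in degree k + 1, is governed by Moore-Penrose inverses of the
differentials. If L₀ and L₁ are those of d in degrees k and k + 1 on a subcomplex, put K = L₀* L₀ +
L₁ L₁*. The eigenpairs (λ, u) of that subcomplex are exactly the nonzero u in V with K u = λ⁻¹ u; λ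
= 0 is impossible because u would then be harmonic and orthogonal to itself. The continuous and
discrete K are compact, symmetric and nonnegative on the same Hilbert space W, so they can be
compared in operator norm, and ‖K_h - K‖ → 0 follows from ‖L_h - L‖ → 0 in the two degrees.

For this convergence (`IsPseudoinverse.tendsto_norm_sub`), let P and P_h be the orthogonal
projections onto the closures of dV and dV_h. Then L_h - L = (L_h - L P_h) + L (P_h - P). The first
term is dominated by (1 - π_h) L P_h, because π_h L P_h f and L_h f differ by a discrete cocycle, to
which both L_h f and L P_h f are orthogonal. The second is controlled through L* L. Compactness of L
upgrades the pointwise convergence given by the approximation property to norm convergence. That L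
is compact comes from the compactness property: its values are orthogonal to cocycles, hence
coclosed, with bounded differential.

Weyl's inequality then gives convergence of the λ⁻¹, hence of the λ. A residual argument across the
spectral gap shows that eigenvectors of one problem are close in W to the spectral subspace of the
other. The graph norm comes for free, since d K = L₁* also converges in norm. -/

theorem IsCompactOperator.eventually_norm_le {ι X Y E : Type*} {l : Filter ι}
    [NormedAddCommGroup X] [NormedSpace ℝ X] [NormedAddCommGroup Y] [NormedSpace ℝ Y]
    [NormedAddCommGroup E] [NormedSpace ℝ E] {T : X →L[ℝ] Y} (hT : IsCompactOperator T)
    (G : ι → X →ₗ[ℝ] E) (c : ℝ) (hG : ∀ i x, ‖G i x‖ ≤ c * ‖T x‖)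
    (hlim : ∀ x, ∀ ε > 0, ∀ᶠ i in l, ‖G i x‖ ≤ ε) {ε : ℝ} (hε : 0 < ε) :
    ∀ᶠ i in l, ∀ x, ‖G i x‖ ≤ ε * ‖x‖ := by
  -- By the domination hypothesis `G i x` depends only on `T x`, and does so with a Lipschitz
  -- constant uniform in `i`. Pointwise smallness on a finite net of the image of the ball therefore
  -- suffices.
  have htb : TotallyBounded (T '' Metric.closedBall 0 1) :=
    (hT.isCompact_closure_image_closedBall 1).totallyBounded.subset subset_closure
  set c' := max c 1 with hc'
  have hc'0 : 0 < c' := lt_of_lt_of_le one_pos (le_max_right _ _)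
  obtain ⟨t, hts, htf, hcov⟩ := Metric.finite_approx_of_totallyBounded htb (ε / (2 * c'))
    (by positivity)
  have hev : ∀ᶠ i in l, ∀ y ∈ t, ∀ x, T x = y → ‖G i x‖ ≤ ε / 2 := by
    rw [Set.Finite.eventually_all htf]
    intro y hy
    obtain ⟨x₀, -, rfl⟩ := hts hy
    filter_upwards [hlim x₀ (ε / 2) (by positivity)] with i hi x hx
    have h1 : G i x = G i x₀ := by
      have := hG i (x - x₀)
      rw [map_sub, map_sub, hx, sub_self, norm_zero, mul_zero] at this
      exact sub_eq_zero.1 (norm_le_zero_iff.1 this)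
    rwa [h1]
  filter_upwards [hev] with i hi
  have hunit : ∀ x, ‖x‖ ≤ 1 → ‖G i x‖ ≤ ε := by
    intro x hx
    have hmem : T x ∈ T '' Metric.closedBall 0 1 := ⟨x, by simpa using hx, rfl⟩
    obtain ⟨y, hy, hxy⟩ := Set.mem_iUnion₂.1 (hcov hmem)
    obtain ⟨x₀, -, rfl⟩ := hts hy
    rw [Metric.mem_ball, dist_eq_norm, ← map_sub] at hxy
    have h1 : ‖G i (x - x₀)‖ ≤ ε / 2 := by
      calc ‖G i (x - x₀)‖ ≤ c * ‖T (x - x₀)‖ := hG _ _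
        _ ≤ c' * (ε / (2 * c')) := by
            gcongr
            exact le_max_left _ _
        _ = ε / 2 := by field_simp
    calc ‖G i x‖ = ‖G i (x - x₀) + G i x₀‖ := by rw [map_sub, sub_add_cancel]
      _ ≤ ε / 2 + ε / 2 := (norm_add_le _ _).trans (add_le_add h1 (hi _ hy _ rfl))
      _ = ε := by ring
  intro x
  rcases eq_or_ne x 0 with rfl | hx
  · simp
  have hx' : 0 < ‖x‖ := norm_pos_iff.2 hx
  have := hunit (‖x‖⁻¹ • x) (by rw [norm_smul, norm_inv, norm_norm, inv_mul_cancel₀ hx'.ne'])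
  rw [map_smul, norm_smul, norm_inv, norm_norm, inv_mul_le_iff₀ hx'] at this
  linarith

/-! ### Moore-Penrose inverses: existence and norm convergence. -/

section Pseudoinverse

variable {X Y : Type*} [NormedAddCommGroup X] [InnerProductSpace ℝ X] [NormedAddCommGroup Y]
  [InnerProductSpace ℝ Y] {V : Submodule ℝ X}

/-- `s ∈ S` is the least squares solution of `D s = f`, of minimal norm. -/
structure IsMinimalSolution (D : V →ₗ[ℝ] Y) (S : Submodule ℝ V) (f : Y) (s : V) : Prop where
  mem : s ∈ S
  orthogonal_ker : ∀ z ∈ S, D z = 0 → ⟪(z : X), (s : X)⟫_ℝ = 0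
  orthogonal_range : ∀ x ∈ S, ⟪D x, f - D s⟫_ℝ = 0

theorem IsMinimalSolution.unique {D : V →ₗ[ℝ] Y} {S : Submodule ℝ V} {f : Y} {s t : V}
    (hs : IsMinimalSolution D S f s) (ht : IsMinimalSolution D S f t) : s = t := by
  have hmem : s - t ∈ S := S.sub_mem hs.mem ht.mem
  have hD : D (s - t) = 0 := by
    have h1 := hs.orthogonal_range _ hmem
    have h2 := ht.orthogonal_range _ hmem
    rw [← inner_self_eq_zero (𝕜 := ℝ)]
    nth_rewrite 2 [map_sub]
    rw [show D s - D t = (f - D t) - (f - D s) by abel, inner_sub_right, h1, h2, sub_zero]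
  have h1 := hs.orthogonal_ker _ hmem hD
  have h2 := ht.orthogonal_ker _ hmem hD
  have : ((s - t : V) : X) = 0 := by
    rw [← inner_self_eq_zero (𝕜 := ℝ)]
    nth_rewrite 2 [Submodule.coe_sub]
    rw [inner_sub_right, h1, h2, sub_zero]
  exact sub_eq_zero.1 (Subtype.ext this)

/-- `L` is the Moore-Penrose inverse of the restriction of `D` to `S`. -/
def IsPseudoinverse (D : V →ₗ[ℝ] Y) (S : Submodule ℝ V) (L : Y →L[ℝ] X) : Prop :=
  ∀ f, ∃ s : V, (s : X) = L f ∧ IsMinimalSolution D S f s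

/-- Project `f` onto the closed range, take a preimage and remove its component in the kernel, which
is closed because the graph is. Uniqueness of minimal solutions makes this linear, and the closed
graph theorem makes it bounded. -/
theorem exists_isPseudoinverse [CompleteSpace X] [CompleteSpace Y] (D : V →ₗ[ℝ] Y)
    (S : Submodule ℝ V) (hgraph : IsClosed {p : X × Y | ∃ x ∈ S, ((x : X), D x) = p})
    (hrange : IsClosed (S.map D : Set Y)) : ∃ L : Y →L[ℝ] X, IsPseudoinverse D S L := by
  set Z : Submodule ℝ X := (S ⊓ LinearMap.ker D).map V.subtype with hZdef
  have hZ : IsClosed (Z : Set X) := by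
    have : (Z : Set X) = (fun x : X => (x, (0 : Y))) ⁻¹'
        {p : X × Y | ∃ x ∈ S, ((x : X), D x) = p} := by
      ext x
      simp only [hZdef, SetLike.mem_coe, Submodule.mem_map, Submodule.mem_inf, LinearMap.mem_ker,
        Set.mem_preimage, Set.mem_ofPred_eq, Prod.mk.injEq, Submodule.subtype_apply]
      exact ⟨fun ⟨y, ⟨h1, h2⟩, h3⟩ => ⟨y, h1, h3, h2⟩, fun ⟨y, h1, h3, h2⟩ => ⟨y, ⟨h1, h2⟩, h3⟩⟩
    rw [this]
    exact hgraph.preimage (by fun_prop)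
  have : CompleteSpace Z := hZ.completeSpace_coe
  have : CompleteSpace (S.map D) := hrange.completeSpace_coe
  have key : ∀ f : Y, ∃ s : V, IsMinimalSolution D S f s ∧ D s = (S.map D).starProjection f := by
    intro f
    obtain ⟨s₀, hs₀, hDs₀⟩ := (S.map D).starProjection_apply_mem f
    obtain ⟨z, ⟨hzS, hzD⟩, hz⟩ := Z.starProjection_apply_mem (s₀ : X)
    have hzD : D z = 0 := hzD
    have hD : D (s₀ - z) = (S.map D).starProjection f := by rw [map_sub, hDs₀, hzD, sub_zero]
    refine ⟨s₀ - z, ⟨S.sub_mem hs₀ hzS, ?_, ?_⟩, hD⟩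
    · intro w hw hDw
      have h1 := Z.sub_starProjection_mem_orthogonal (s₀ : X)
      rw [← hz] at h1
      exact h1 w ⟨w, ⟨hw, hDw⟩, rfl⟩
    · intro x hx
      rw [hD]
      exact (S.map D).sub_starProjection_mem_orthogonal f _ ⟨x, hx, rfl⟩
  choose g hg hDg using key
  let G : Y →ₗ[ℝ] X :=
    { toFun := fun f => g f
      map_add' := by
        intro a b
        rw [← Submodule.coe_add]
        congr 1
        refine (hg (a + b)).unique ⟨S.add_mem (hg a).mem (hg b).mem, ?_, ?_⟩
        · intro z hz hDz
          rw [Submodule.coe_add, inner_add_right, (hg a).orthogonal_ker z hz hDz,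
            (hg b).orthogonal_ker z hz hDz, add_zero]
        · intro x hx
          rw [map_add, add_sub_add_comm, inner_add_right, (hg a).orthogonal_range x hx,
            (hg b).orthogonal_range x hx, add_zero]
      map_smul' := by
        intro r a
        rw [RingHom.id_apply, ← Submodule.coe_smul]
        congr 1
        refine (hg (r • a)).unique ⟨S.smul_mem r (hg a).mem, ?_, ?_⟩
        · intro z hz hDz
          rw [Submodule.coe_smul, inner_smul_right, (hg a).orthogonal_ker z hz hDz, mul_zero]
        · intro x hx
          rw [map_smul, ← smul_sub, inner_smul_right, (hg a).orthogonal_range x hx, mul_zero] }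
  have hG : Continuous G := by
    refine G.continuous_of_seq_closed_graph fun u x y hu hy => ?_
    have hlim : Tendsto (fun n => (G (u n), D (g (u n)))) atTop
        (𝓝 (y, (S.map D).starProjection x)) := by
      refine Tendsto.prodMk_nhds hy ?_
      simp only [hDg]
      exact ((S.map D).starProjection.continuous.tendsto x).comp hu
    obtain ⟨t, ht, hty⟩ := hgraph.mem_of_tendsto hlim
      (Eventually.of_forall fun n => ⟨g (u n), (hg (u n)).mem, rfl⟩)
    obtain ⟨rfl, hDt⟩ := Prod.mk.inj hty
    change (t : X) = g x
    congr 1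
    refine IsMinimalSolution.unique (D := D) (S := S) (f := x) ⟨ht, ?_, ?_⟩ (hg x)
    · intro z hz hDz
      have h1 : Tendsto (fun n => ⟪(z : X), G (u n)⟫_ℝ) atTop (𝓝 ⟪(z : X), (t : X)⟫_ℝ) :=
        tendsto_const_nhds.inner hy
      refine tendsto_nhds_unique h1 ?_
      have : ∀ n, ⟪(z : X), G (u n)⟫_ℝ = 0 := fun n => (hg (u n)).orthogonal_ker z hz hDz
      simp only [this]
      exact tendsto_const_nhds
    · intro w hw
      rw [hDt]
      exact (S.map D).sub_starProjection_mem_orthogonal x _ ⟨w, hw, rfl⟩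
  exact ⟨⟨G, hG⟩, fun f => ⟨g f, rfl, hg f⟩⟩

namespace IsPseudoinverse

variable {D : V →ₗ[ℝ] Y} {S : Submodule ℝ V} {L : Y →L[ℝ] X}

theorem eq_of_isMinimalSolution (hL : IsPseudoinverse D S L) {f : Y} {s : V}
    (hs : IsMinimalSolution D S f s) : (s : X) = L f := by
  obtain ⟨t, ht, ht'⟩ := hL f
  rw [hs.unique ht', ht]

theorem inner_ker (hL : IsPseudoinverse D S L) {z : V} (hz : z ∈ S) (hDz : D z = 0) (f : Y) :
    ⟪(z : X), L f⟫_ℝ = 0 := by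
  obtain ⟨t, ht, ht'⟩ := hL f
  rw [← ht]
  exact ht'.orthogonal_ker z hz hDz

/-- `L D` is the orthogonal projection, within `S`, onto the complement of the kernel of `D`. -/
theorem exists_apply_map (hL : IsPseudoinverse D S L) {x : V} (hx : x ∈ S) :
    ∃ s ∈ S, (s : X) = L (D x) ∧ D s = D x := by
  obtain ⟨t, ht, ht'⟩ := hL (D x)
  refine ⟨t, ht'.mem, ht, ?_⟩
  have := ht'.orthogonal_range _ (S.sub_mem hx ht'.mem)
  rw [map_sub, inner_self_eq_zero] at this
  exact (sub_eq_zero.1 this).symm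

theorem apply_eq_zero (hL : IsPseudoinverse D S L) {e : Y} (he : ∀ x ∈ S, ⟪D x, e⟫_ℝ = 0) :
    L e = 0 := by
  rw [← hL.eq_of_isMinimalSolution (s := 0) ⟨S.zero_mem, by simp, by simpa using he⟩,
    Submodule.coe_zero]

theorem inner_apply_map (hL : IsPseudoinverse D S L) {x : V} (hx : x ∈ S) (f : Y) :
    ⟪L (D x), L f⟫_ℝ = ⟪(x : X), L f⟫_ℝ := by
  obtain ⟨s, hs, hsL, hDs⟩ := hL.exists_apply_map hx
  have := hL.inner_ker (S.sub_mem hs hx) (by rw [map_sub, hDs, sub_self]) f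
  rwa [Submodule.coe_sub, inner_sub_left, sub_eq_zero, hsL] at this

/-- The least squares residual e of L* x is orthogonal to the range of `D`, so L e = 0; hence e is
also orthogonal to L* x, and so to itself. -/
theorem exists_map_eq_adjoint [CompleteSpace X] [CompleteSpace Y] (hL : IsPseudoinverse D S L)
    (x : X) : ∃ w ∈ S, D w = L.adjoint x := by
  obtain ⟨s, -, hs⟩ := hL (L.adjoint x)
  refine ⟨s, hs.mem, ?_⟩
  set e := L.adjoint x - D s with he
  have h1 : L e = 0 := hL.apply_eq_zero hs.orthogonal_range
  have h2 : ⟪e, L.adjoint x⟫_ℝ = 0 := by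
    rw [ContinuousLinearMap.adjoint_inner_right, h1, inner_zero_left]
  have h3 : ⟪e, D s⟫_ℝ = 0 := by rw [real_inner_comm]; exact hs.orthogonal_range s hs.mem
  have h4 : ⟪e, e⟫_ℝ = 0 := by
    conv_lhs => enter [2]; rw [he]
    rw [inner_sub_right, h2, h3, sub_zero]
  exact (sub_eq_zero.1 (inner_self_eq_zero.1 h4)).symm

theorem map_eq_starProjection [CompleteSpace Y] {f : Y} {s : V} (hs : IsMinimalSolution D S f s) :
    D s = (S.map D).topologicalClosure.starProjection f := by
  symm
  refine Submodule.eq_starProjection_of_mem_orthogonal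
    (Submodule.le_topologicalClosure _ ⟨s, hs.mem, rfl⟩) ?_
  rw [Submodule.orthogonal_closure]
  rintro _ ⟨x, hx, rfl⟩
  exact hs.orthogonal_range x hx

theorem isCompactOperator_of_finiteDimensional [FiniteDimensional ℝ S]
    (hL : IsPseudoinverse D S L) : IsCompactOperator L := by
  set F : Submodule ℝ X := S.map V.subtype
  have hF : ∀ f, L f ∈ F := fun f => by
    obtain ⟨s, hs, hs'⟩ := hL f
    exact ⟨s, hs'.mem, hs⟩
  have : FiniteDimensional ℝ F := inferInstance
  have : ProperSpace F := FiniteDimensional.proper ℝ F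
  exact (isCompactOperator_of_locallyCompactSpace_dom (L.codRestrict F hF)).clm_comp F.subtypeL

/-- The heart of the convergence proof. The commutation of π with the differential enters only on
preimages of discrete coboundaries (`hπ_D`), so no projection on `Y` is needed. -/
theorem tendsto_norm_sub [CompleteSpace X] [CompleteSpace Y] {ι : Type*} {l : Filter ι}
    (hL : IsPseudoinverse D ⊤ L) (hcpt : IsCompactOperator L) {Sh : ι → Submodule ℝ V}
    {Lh : ι → Y →L[ℝ] X} (hLh : ∀ i, IsPseudoinverse D (Sh i) (Lh i)) (π : ι → V →ₗ[ℝ] V)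
    (hπ_mem : ∀ i v, π i v ∈ Sh i) (hπ_id : ∀ i, ∀ v ∈ Sh i, π i v = v)
    (hπ_D : ∀ i, ∀ s ∈ Sh i, ∀ t, D t = D s → D (π i t) = D s)
    {c : ℝ} (hπ_le : ∀ i v, ‖(π i v : X)‖ ≤ c * ‖(v : X)‖)
    (happ : ∀ u : V, ∀ ε > 0, ∀ᶠ i in l, ∃ v ∈ Sh i, ‖((u - v : V) : X)‖ < ε ∧ ‖D (u - v)‖ < ε) :
    Tendsto (fun i => ‖Lh i - L‖) l (𝓝 0) := by
  have hLV : ∀ f, L f ∈ V := fun f => by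
    obtain ⟨s, hs, -⟩ := hL f
    rw [← hs]
    exact s.2
  let t : Y →ₗ[ℝ] V := L.toLinearMap.codRestrict V hLV
  have ht : ∀ f, (t f : X) = L f := fun f => rfl
  let P : Y →L[ℝ] Y := ((⊤ : Submodule ℝ V).map D).topologicalClosure.starProjection
  let Ph : ι → Y →L[ℝ] Y := fun i => ((Sh i).map D).topologicalClosure.starProjection
  have hP_le : ∀ f, ‖P f‖ ≤ ‖f‖ := Submodule.norm_starProjection_apply_le _
  have hPh_le : ∀ i f, ‖Ph i f‖ ≤ ‖f‖ := fun i => Submodule.norm_starProjection_apply_le _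
  have hQ_le : ∀ i f, ‖(Ph i - P) f‖ ≤ 2 * ‖f‖ := fun i f => by
    have := norm_sub_le (Ph i f) (P f)
    rw [sub_apply]
    linarith [hP_le f, hPh_le i f]
  have hproj : ∀ ε > 0, ∀ᶠ i in l, ∀ f, ‖((t f - π i (t f) : V) : X)‖ ≤ ε * ‖f‖ := by
    intro ε hε
    have hb : ∀ i (v : V), ‖((v - π i v : V) : X)‖ ≤ (1 + |c|) * ‖(v : X)‖ := fun i v => by
      rw [Submodule.coe_sub]
      have h1 := norm_sub_le (v : X) (π i v : X)
      have h2 := hπ_le i v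
      have h3 : c * ‖(v : X)‖ ≤ |c| * ‖(v : X)‖ := by gcongr; exact le_abs_self c
      linarith
    let G : ι → Y →ₗ[ℝ] X := fun i => V.subtype ∘ₗ (LinearMap.id - π i) ∘ₗ t
    have hG : ∀ i f, G i f = ((t f - π i (t f) : V) : X) := fun i f => rfl
    simp only [← hG]
    refine hcpt.eventually_norm_le G (1 + |c|) (fun i f => hb i (t f)) ?_ hε
    intro f ε hε
    have hc : 0 < 1 + |c| := by positivity
    filter_upwards [happ (t f) (ε / (1 + |c|)) (by positivity)] with i ⟨v, hv, hv', _⟩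
    have h1 := hb i (t f - v)
    have h2 : (t f - v) - π i (t f - v) = t f - π i (t f) := by
      rw [map_sub, hπ_id i v hv]; abel
    rw [h2] at h1
    refine (hG i f ▸ h1).trans ?_
    rw [lt_div_iff₀ hc] at hv'
    linarith
  -- L* takes values in the range of `D`. There `Ph i - P` tends to zero pointwise, since both
  -- projections fix `D v` for discrete `v`. Composing with L* L, which is compact because L is,
  -- makes this uniform.
  have hrange : ∀ ε > 0, ∀ᶠ i in l, ∀ f, ‖(Ph i - P) (L.adjoint (L f))‖ ≤ ε * ‖f‖ := by
    intro ε hε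
    have hc2 : IsCompactOperator (L.adjoint ∘L L) := hcpt.clm_comp L.adjoint
    refine hc2.eventually_norm_le
      (fun i => ((Ph i - P) ∘L (L.adjoint ∘L L)).toLinearMap) 2 (fun i f => hQ_le i _) ?_ hε
    intro f ε hε
    obtain ⟨w, -, hw⟩ := hL.exists_map_eq_adjoint (L f)
    filter_upwards [happ w (ε / 2) (by positivity)] with i ⟨v, hv, _, hv'⟩
    have h1 : (Ph i - P) (D v) = 0 := by
      rw [sub_apply, sub_eq_zero]
      refine (Submodule.starProjection_eq_self_iff.2
        (Submodule.le_topologicalClosure _ (Submodule.mem_map_of_mem hv))).trans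
        (Submodule.starProjection_eq_self_iff.2
        (Submodule.le_topologicalClosure _ (Submodule.mem_map_of_mem Submodule.mem_top))).symm
    have h2 : (Ph i - P) (L.adjoint (L f)) = (Ph i - P) (D (w - v)) := by
      rw [map_sub, map_sub, h1, sub_zero, hw]
    have h3 := hQ_le i (D (w - v))
    change ‖(Ph i - P) (L.adjoint (L f))‖ ≤ ε
    rw [h2]
    linarith
  have hterm : ∀ i f, ‖Lh i f - L (Ph i f)‖ ≤ ‖((t (Ph i f) - π i (t (Ph i f)) : V) : X)‖ := by
    intro i f
    obtain ⟨s, hs, hs'⟩ := hLh i f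
    have hDs : D s = Ph i f := map_eq_starProjection hs'
    have hDt : D (t (Ph i f)) = D s := by
      obtain ⟨r, -, hr, hr'⟩ := hL.exists_apply_map (x := s) trivial
      rw [hDs] at hr
      rw [← hr']
      congr 1
      exact Subtype.ext hr.symm
    have hz : D (π i (t (Ph i f)) - s) = 0 := by
      rw [map_sub, hπ_D i s hs'.mem _ hDt, sub_self]
    have hzm : π i (t (Ph i f)) - s ∈ Sh i := (Sh i).sub_mem (hπ_mem _ _) hs'.mem
    have h1 := hs'.orthogonal_ker _ hzm hz
    have h2 := hL.inner_ker (z := π i (t (Ph i f)) - s) trivial hz (Ph i f)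
    rw [← hs, ← ht]
    set a : X := (t (Ph i f) : X)
    set b : X := (π i (t (Ph i f)) : X)
    rw [Submodule.coe_sub] at h1 h2 ⊢
    change ⟪b - s, a⟫_ℝ = 0 at h2
    change ⟪b - s, (s : X)⟫_ℝ = 0 at h1
    -- Both `a` and `s` are orthogonal to the discrete cocycle `b - s`, so Cauchy-Schwarz bounds `‖a
    -- - s‖` by the projection error `‖a - b‖`.
    have h3 : ⟪a - s, a - s⟫_ℝ = ⟪a - b, a - s⟫_ℝ := by
      have : ⟪b - s, a - s⟫_ℝ = 0 := by rw [inner_sub_right, h1, h2, sub_zero]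
      rw [show a - s = (a - b) + (b - s) by abel, inner_add_left,
        ← show a - s = (a - b) + (b - s) by abel, this, add_zero]
    rw [norm_sub_rev]
    by_cases h0 : ‖a - s‖ = 0
    · rw [h0]; positivity
    · have h4 := real_inner_le_norm (a - b) (a - s)
      rw [← h3, real_inner_self_eq_norm_mul_norm] at h4
      exact le_of_mul_le_mul_right h4 (lt_of_le_of_ne (norm_nonneg _) (Ne.symm h0))
  -- With Q = `Ph i - P` symmetric and ‖Q‖ ≤ 2, one has ‖L Q f‖² = ⟨Q L* L Q f, f⟩. This explains
  -- the tolerance ε² / 2.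
  have hsq : ∀ ε > 0, ∀ᶠ i in l, ∀ f, ‖L ((Ph i - P) f)‖ ≤ ε * ‖f‖ := by
    intro ε hε
    filter_upwards [hrange (ε ^ 2 / 2) (by positivity)] with i hi f
    have h1 : ‖L ((Ph i - P) f)‖ ^ 2 = ⟪(Ph i - P) (L.adjoint (L ((Ph i - P) f))), f⟫_ℝ := by
      have hsymm : ∀ a b, ⟪(Ph i - P) a, b⟫_ℝ = ⟪a, (Ph i - P) b⟫_ℝ := fun a b => by
        simp only [sub_apply, inner_sub_left, inner_sub_right]
        congr 1
        · exact Submodule.inner_starProjection_left_eq_right _ a b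
        · exact Submodule.inner_starProjection_left_eq_right _ a b
      rw [hsymm, ContinuousLinearMap.adjoint_inner_left, real_inner_self_eq_norm_sq]
    have h2 := real_inner_le_norm ((Ph i - P) (L.adjoint (L ((Ph i - P) f)))) f
    have h3 := hi ((Ph i - P) f)
    have h4 := hQ_le i f
    have h5 : ‖L ((Ph i - P) f)‖ ^ 2 ≤ (ε * ‖f‖) ^ 2 := by
      rw [h1]
      calc _ ≤ _ := h2
        _ ≤ (ε ^ 2 / 2 * (2 * ‖f‖)) * ‖f‖ := by
          gcongr
          exact h3.trans (by gcongr)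
        _ = (ε * ‖f‖) ^ 2 := by ring
    exact (sq_le_sq₀ (norm_nonneg _) (by positivity)).1 h5
  rw [Metric.tendsto_nhds]
  intro ε hε
  filter_upwards [hproj (ε / 3) (by positivity), hsq (ε / 3) (by positivity)] with i h1 h2
  rw [Real.dist_eq, sub_zero, abs_norm]
  refine lt_of_le_of_lt (ContinuousLinearMap.opNorm_le_bound _ (M := 2 * (ε / 3)) (by positivity)
    fun f => ?_) (by linarith)
  have hLP : L (P f) = L f := by
    obtain ⟨s, hs, hs'⟩ := hL f
    rw [show P f = D s from (map_eq_starProjection hs').symm]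
    have h0 := hL.apply_eq_zero hs'.orthogonal_range
    rw [map_sub, sub_eq_zero] at h0
    exact h0.symm
  have h3 : (Lh i - L) f = (Lh i f - L (Ph i f)) + L ((Ph i - P) f) := by
    simp only [sub_apply, map_sub, hLP]
    abel
  rw [h3]
  have h4 := (hterm i f).trans (h1 (Ph i f))
  have h5 : ε / 3 * ‖Ph i f‖ ≤ ε / 3 * ‖f‖ := by gcongr; exact hPh_le i f
  have h6 := norm_add_le (Lh i f - L (Ph i f)) (L ((Ph i - P) f))
  linarith [h2 f]

end IsPseudoinverse

end Pseudoinverse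

/-! ### Spectral theory of compact nonnegative operators. -/

section Spectral

variable {H : Type*} [NormedAddCommGroup H] [InnerProductSpace ℝ H]

/-- `a i`, `i < N`, are the nonzero eigenvalues of `K`, all of them positive, in nonincreasing
order and repeated according to multiplicity, with orthonormal eigenvectors `v i`. -/
structure IsSpectralSystem (K : H →L[ℝ] H) (N : ℕ∞) (a : ℕ → ℝ) (v : ℕ → H) : Prop where
  apply_eq : ∀ i : ℕ, (i : ℕ∞) < N → K (v i) = a i • v i
  pos : ∀ i : ℕ, (i : ℕ∞) < N → 0 < a i
  anti : ∀ i j : ℕ, i ≤ j → (j : ℕ∞) < N → a j ≤ a i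
  orthonormal : Orthonormal ℝ fun i : {i : ℕ // (i : ℕ∞) < N} => v i
  complete : ∀ (μ : ℝ) (u : H), μ ≠ 0 → K u = μ • u →
    u ∈ Submodule.span ℝ (v '' {i : ℕ | (i : ℕ∞) < N ∧ a i = μ})

/-- Compact, symmetric and nonnegative operators. -/
structure IsCompactNonneg (K : H →L[ℝ] H) : Prop where
  compact : IsCompactOperator K
  symm : ∀ x y, ⟪K x, y⟫_ℝ = ⟪x, K y⟫_ℝ
  nonneg : ∀ x, 0 ≤ ⟪K x, x⟫_ℝ

namespace IsCompactNonneg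

variable {K : H →L[ℝ] H}

/-- Otherwise ‖K‖ would lie in the resolvent set and the Rayleigh quotients, nonnegative here, would
stay a fixed distance below their supremum ‖K‖. -/
theorem exists_norm_eigenvector [CompleteSpace H] (hK : IsCompactNonneg K) (h0 : K ≠ 0) :
    ∃ u, ‖u‖ = 1 ∧ K u = ‖K‖ • u := by
  have hn : ‖K‖ ≠ 0 := norm_ne_zero_iff.2 h0
  have hnt : Nontrivial H := by
    by_contra h
    rw [not_nontrivial_iff_subsingleton] at h
    exact h0 (ContinuousLinearMap.ext fun x => Subsingleton.elim _ _)
  have hsymm : K.IsSymmetric := hK.symm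
  rcases hK.compact.hasEigenvalue_or_mem_resolventSet hn with h | h
  · obtain ⟨u, hu⟩ := h.exists_hasEigenvector
    have hu0 : ‖u‖ ≠ 0 := norm_ne_zero_iff.2 hu.2
    refine ⟨‖u‖⁻¹ • u, by rw [norm_smul, norm_inv, norm_norm, inv_mul_cancel₀ hu0], ?_⟩
    have := hu.apply_eq_smul
    rw [map_smul, smul_comm]
    congr 1
  · exfalso
    obtain ⟨ε, hε, hle⟩ := K.rayleighQuotient_le_of_norm_mem_resolventSet h
    have h1 := K.norm_eq_iSup_rayleighQuotient hsymm
    have h2 : ∀ x, |K.rayleighQuotient x| ≤ ‖K‖ - ε := fun x => by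
      rw [abs_of_nonneg]
      · exact hle x
      · exact div_nonneg (hK.nonneg x) (by positivity)
    have h3 := ciSup_le h2
    rw [← h1] at h3
    linarith

/-- `M` is the norm of `K` on the invariant subspace `Fᗮ`, attained by an eigenvector when positive.
This is both the greedy step of the spectral theorem and the source of the bound on spectral
complements. -/
theorem exists_bound_orthogonal [CompleteSpace H] (hK : IsCompactNonneg K) (F : Submodule ℝ H)
    (hF : ∀ x ∈ F, K x ∈ F) :
    ∃ M, 0 ≤ M ∧ (∀ x ∈ Fᗮ, ‖K x‖ ≤ M * ‖x‖) ∧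
      (0 < M → ∃ u ∈ Fᗮ, ‖u‖ = 1 ∧ K u = M • u) := by
  have hF' : ∀ x ∈ Fᗮ, K x ∈ Fᗮ := fun x hx y hy => by
    rw [← hK.symm]
    exact hx _ (hF y hy)
  set P : H →L[ℝ] H := Fᗮ.starProjection with hP
  have hPm : ∀ x, P x ∈ Fᗮ := fun x => Fᗮ.starProjection_apply_mem x
  have hPi : ∀ x ∈ Fᗮ, P x = x := fun x hx => Submodule.starProjection_eq_self_iff.2 hx
  have hPs : ∀ x y, ⟪P x, y⟫_ℝ = ⟪x, P y⟫_ℝ := Submodule.inner_starProjection_left_eq_right _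
  have hKP : ∀ x y, ⟪K (P x), y⟫_ℝ = ⟪K (P x), P y⟫_ℝ := fun x y => by
    rw [← hPs, hPi _ (hF' _ (hPm x))]
  have hKF : IsCompactNonneg (K ∘L P) :=
    { compact := hK.compact.comp_clm P
      symm := fun x y => by
        change ⟪K (P x), y⟫_ℝ = ⟪x, K (P y)⟫_ℝ
        rw [hKP, hK.symm, real_inner_comm, ← hKP, real_inner_comm]
      nonneg := fun x => by
        change 0 ≤ ⟪K (P x), x⟫_ℝ
        rw [hKP]
        exact hK.nonneg _ }
  refine ⟨‖K ∘L P‖, norm_nonneg _, fun x hx => ?_, fun hpos => ?_⟩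
  · have := (K ∘L P).le_opNorm x
    rwa [ContinuousLinearMap.comp_apply, hPi x hx] at this
  · obtain ⟨u, hu, hKu⟩ := hKF.exists_norm_eigenvector (norm_pos_iff.1 hpos)
    have hmem : u ∈ Fᗮ := by
      have h1 : u = ‖K ∘L P‖⁻¹ • K (P u) := by
        rw [eq_inv_smul_iff₀ hpos.ne', ← hKu]; rfl
      rw [h1]
      exact Submodule.smul_mem _ _ (hF' _ (hPm u))
    refine ⟨u, hmem, hu, ?_⟩
    rwa [ContinuousLinearMap.comp_apply, hPi u hmem] at hKu

/-- The images of distinct `w n` are more than `μ` apart, so no subsequence of them is Cauchy. -/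
theorem false_of_orthonormal (hK : IsCompactNonneg K) {w : ℕ → H} (hw : Orthonormal ℝ w)
    {b : ℕ → ℝ} (hb : ∀ n, K (w n) = b n • w n) {μ : ℝ} (hμ : 0 < μ) (hμb : ∀ n, μ ≤ b n) :
    False := by
  have hc := hK.compact.isCompact_closure_image_closedBall 1
  have hmem : ∀ n, K (w n) ∈ closure (K '' Metric.closedBall 0 1) := fun n =>
    subset_closure ⟨w n, by simp [hw.1 n], rfl⟩
  obtain ⟨y, -, φ, hφ, hlim⟩ := hc.tendsto_subseq hmem
  obtain ⟨n₀, hn₀⟩ := Metric.cauchySeq_iff.1 hlim.cauchySeq μ hμ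
  have h1 := hn₀ n₀ le_rfl (n₀ + 1) (Nat.le_succ _)
  have hne : φ n₀ ≠ φ (n₀ + 1) := (hφ (Nat.lt_succ_self n₀)).ne
  rw [dist_eq_norm, Function.comp_apply, Function.comp_apply, hb, hb] at h1
  have h2 : ‖b (φ n₀) • w (φ n₀) - b (φ (n₀ + 1)) • w (φ (n₀ + 1))‖ ^ 2
      = b (φ n₀) ^ 2 + b (φ (n₀ + 1)) ^ 2 := by
    rw [norm_sub_sq_real, inner_smul_left, inner_smul_right, hw.2 hne, norm_smul, norm_smul,
      hw.1, hw.1]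
    simp
  have h3 := pow_lt_pow_left₀ h1 (norm_nonneg _) two_ne_zero
  nlinarith [hμb (φ n₀), sq_nonneg (b (φ (n₀ + 1)))]

theorem mem_span_of_finite_eigenvectors {T : Set H} (hT : T.Finite) {μ : ℝ}
    (hTμ : ∀ x ∈ T, K x = μ • x) {u : H} (hu : K u = μ • u)
    (h0 : ∀ w, K w = μ • w → (∀ x ∈ T, ⟪x, w⟫_ℝ = 0) → w = 0) : u ∈ Submodule.span ℝ T := by
  have : FiniteDimensional ℝ (Submodule.span ℝ T) := FiniteDimensional.span_of_finite ℝ hT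
  have heig : ∀ x ∈ Submodule.span ℝ T, K x = μ • x := by
    intro x hx
    have : Submodule.span ℝ T ≤ LinearMap.ker (K.toLinearMap - μ • LinearMap.id) :=
      Submodule.span_le.2 fun x hx => by simp [hTμ x hx]
    simpa [sub_eq_zero] using this hx
  set p := (Submodule.span ℝ T).starProjection u
  have hp : p ∈ Submodule.span ℝ T := Submodule.starProjection_apply_mem _ u
  have hw := h0 (u - p) (by rw [map_sub, hu, heig p hp, smul_sub]) fun x hx =>
    (Submodule.span ℝ T).sub_starProjection_mem_orthogonal u x (Submodule.subset_span hx)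
  rwa [sub_eq_zero.1 hw]

theorem exists_isSpectralSystem [CompleteSpace H] (hK : IsCompactNonneg K) :
    ∃ N a v, IsSpectralSystem K N a v := by
  -- Greedy choice, made total in `F` so that it can be iterated. Once `M = 0` the chosen vector is
  -- 0, and `N` will be the first such index.
  have step : ∀ F : Submodule ℝ H, ∃ (u : H) (M : ℝ), (∀ x ∈ F, K x ∈ F) →
      u ∈ Fᗮ ∧ K u = M • u ∧ 0 ≤ M ∧ (∀ x ∈ Fᗮ, ‖K x‖ ≤ M * ‖x‖) ∧ (0 < M → ‖u‖ = 1) ∧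
        (M = 0 → u = 0) := by
    intro F
    by_cases hF : ∀ x ∈ F, K x ∈ F
    · obtain ⟨M, hM, hle, hex⟩ := hK.exists_bound_orthogonal F hF
      rcases hM.eq_or_lt with h | h
      · exact ⟨0, M, fun _ => ⟨Submodule.zero_mem _, by simp, hM, hle, fun h' => by linarith,
          fun _ => rfl⟩⟩
      · obtain ⟨u, hu, hu1, hKu⟩ := hex h
        exact ⟨u, M, fun _ => ⟨hu, hKu, hM, hle, fun _ => hu1, fun h' => by linarith⟩⟩
    · exact ⟨0, 0, fun h => absurd h hF⟩
  choose nxt M hstep using step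
  let F : ℕ → Submodule ℝ H := fun n =>
    Nat.rec ⊥ (fun _ G => G ⊔ Submodule.span ℝ {nxt G}) n
  have hFs : ∀ n, F (n + 1) = F n ⊔ Submodule.span ℝ {nxt (F n)} := fun n => rfl
  have hinv : ∀ n, ∀ x ∈ F n, K x ∈ F n := by
    intro n
    induction n with
    | zero => intro x hx; rw [(Submodule.mem_bot ℝ).1 hx, map_zero]; exact Submodule.zero_mem _
    | succ n ih =>
      intro x hx
      rw [hFs] at hx ⊢
      obtain ⟨y, hy, z, hz, rfl⟩ := Submodule.mem_sup.1 hx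
      obtain ⟨r, rfl⟩ := Submodule.mem_span_singleton.1 hz
      rw [map_add, map_smul, (hstep (F n) ih).2.1]
      exact Submodule.add_mem_sup (ih y hy) (Submodule.smul_mem _ _ (Submodule.smul_mem _ _
        (Submodule.mem_span_singleton_self _)))
  set v : ℕ → H := fun n => nxt (F n) with hv
  set a : ℕ → ℝ := fun n => M (F n) with ha
  have hmono : Monotone F := monotone_nat_of_le_succ fun n => by rw [hFs]; exact le_sup_left
  have hvF : ∀ i n, i < n → v i ∈ F n := fun i n hin => hmono (Nat.succ_le_of_lt hin) (by
    rw [Nat.succ_eq_add_one, hFs]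
    exact Submodule.mem_sup_right (Submodule.mem_span_singleton_self _))
  have hvo : ∀ n, v n ∈ (F n)ᗮ := fun n => (hstep (F n) (hinv n)).1
  have hKv : ∀ n, K (v n) = a n • v n := fun n => (hstep (F n) (hinv n)).2.1
  have ha0 : ∀ n, 0 ≤ a n := fun n => (hstep (F n) (hinv n)).2.2.1
  have hbd : ∀ n, ∀ x ∈ (F n)ᗮ, ‖K x‖ ≤ a n * ‖x‖ := fun n => (hstep (F n) (hinv n)).2.2.2.1
  have hv1 : ∀ n, 0 < a n → ‖v n‖ = 1 := fun n => (hstep (F n) (hinv n)).2.2.2.2.1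
  have hv0 : ∀ n, a n = 0 → v n = 0 := fun n => (hstep (F n) (hinv n)).2.2.2.2.2
  have hanti : Antitone a := by
    intro i j hij
    rcases (ha0 j).eq_or_lt with h | h
    · rw [← h]; exact ha0 i
    · have := hbd i (v j) (Submodule.orthogonal_le (hmono hij) (hvo j))
      rwa [hKv, norm_smul, hv1 j h, mul_one, mul_one, Real.norm_of_nonneg (ha0 j)] at this
  obtain ⟨N, hN⟩ : ∃ N : ℕ∞, ∀ i : ℕ, (i : ℕ∞) < N ↔ 0 < a i := by
    by_cases h : ∃ n, a n = 0
    · classical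
      refine ⟨(Nat.find h : ℕ), fun i => ?_⟩
      rw [Nat.cast_lt]
      constructor
      · intro hi
        exact lt_of_le_of_ne (ha0 i) (Ne.symm (Nat.find_min h hi))
      · intro hi
        by_contra hle
        have := hanti (not_lt.1 hle)
        rw [Nat.find_spec h] at this
        linarith
    · refine ⟨⊤, fun i => ⟨fun _ => lt_of_le_of_ne (ha0 i) fun h' => h ⟨i, h'.symm⟩, fun _ => ?_⟩⟩
      exact ENat.natCast_lt_top i
  have horth : ∀ i j, i ≠ j → ⟪v i, v j⟫_ℝ = 0 := by
    intro i j hij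
    rcases lt_or_gt_of_ne hij with h | h
    · exact hvo j _ (hvF i j h)
    · rw [real_inner_comm]
      exact hvo i _ (hvF j i h)
  refine ⟨N, a, v, fun i _ => hKv i, fun i hi => (hN i).1 hi, fun i j hij _ => hanti hij,
    ⟨fun i => hv1 _ ((hN _).1 i.2), fun i j hij => horth _ _ fun h => hij (Subtype.ext h)⟩, ?_⟩
  intro μ u hμ hu
  rcases eq_or_ne u 0 with rfl | hu0
  · exact Submodule.zero_mem _
  have hμ0 : 0 < μ := by
    have h1 := hK.nonneg u
    rw [hu, inner_smul_left, real_inner_self_eq_norm_sq] at h1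
    have h2 : 0 < ‖u‖ ^ 2 := by positivity
    exact lt_of_le_of_ne (nonneg_of_mul_nonneg_left h1 h2) hμ.symm
  -- Compactness forces the `a n` below `μ`. An eigenvector for `μ` orthogonal to all `v i` then
  -- violates the bound `a n` on the complement of `F n`, unless it vanishes.
  obtain ⟨n, hn⟩ : ∃ n, a n < μ := by
    by_contra! h
    refine hK.false_of_orthonormal (w := v)
      ⟨fun i => hv1 i (hμ0.trans_le (h i)), fun i j hij => horth i j hij⟩ hKv hμ0 h
  refine mem_span_of_finite_eigenvectors (((Set.finite_Iio n).subset ?_).image v) ?_ hu ?_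
  · rintro i ⟨-, hi⟩
    by_contra hle
    have := hanti (not_lt.1 hle)
    linarith
  · rintro _ ⟨i, ⟨-, hi⟩, rfl⟩
    rw [hKv, hi]
  · intro w hw hort
    have hvw : ∀ i, ⟪v i, w⟫_ℝ = 0 := by
      intro i
      by_cases hi : a i = μ
      · exact hort _ ⟨i, ⟨(hN i).2 (hi ▸ hμ0), hi⟩, rfl⟩
      · have h1 := hK.symm (v i) w
        rw [hKv, hw, inner_smul_left, inner_smul_right] at h1
        have h2 : (a i - μ) * ⟪v i, w⟫_ℝ = 0 := by
          rw [sub_mul, sub_eq_zero]; simpa using h1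
        exact (mul_eq_zero.1 h2).resolve_left (sub_ne_zero.2 hi)
    have hwF : ∀ n, w ∈ (F n)ᗮ := by
      intro n
      induction n with
      | zero => change w ∈ (⊥ : Submodule ℝ H)ᗮ; simp
      | succ n ih =>
        rw [hFs, ← Submodule.inf_orthogonal]
        exact ⟨ih, Submodule.mem_orthogonal_singleton_iff_inner_right.2 (hvw n)⟩
    have h1 := hbd n w (hwF n)
    rw [hw, norm_smul, Real.norm_of_nonneg hμ0.le] at h1
    by_contra hw0
    have := norm_pos_iff.2 hw0
    nlinarith

end IsCompactNonneg

/-! ### Perturbation of eigenvalues and spectral subspaces. -/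

namespace IsSpectralSystem

open Classical in
/-- The eigenvalues, extended by zero. -/
noncomputable def extend (N : ℕ∞) (a : ℕ → ℝ) (i : ℕ) : ℝ := if (i : ℕ∞) < N then a i else 0

theorem extend_of_lt {N : ℕ∞} {a : ℕ → ℝ} {i : ℕ} (hi : (i : ℕ∞) < N) : extend N a i = a i :=
  if_pos hi

variable {K : H →L[ℝ] H} {N : ℕ∞} {a : ℕ → ℝ} {v : ℕ → H}

theorem extend_nonneg (h : IsSpectralSystem K N a v) (i : ℕ) : 0 ≤ extend N a i := by
  unfold extend
  split_ifs with hi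
  · exact (h.pos i hi).le
  · exact le_rfl

theorem lt_of_extend_pos {i : ℕ} (hi : 0 < extend N a i) : (i : ℕ∞) < N := by
  by_contra hlt
  rw [extend, if_neg hlt] at hi
  exact lt_irrefl _ hi

theorem apply_mem_span (h : IsSpectralSystem K N a v) {T : Set ℕ}
    (hT : ∀ i ∈ T, (i : ℕ∞) < N) {x : H} (hx : x ∈ Submodule.span ℝ (v '' T)) :
    K x ∈ Submodule.span ℝ (v '' T) := by
  have : Submodule.span ℝ (v '' T) ≤ (Submodule.span ℝ (v '' T)).comap K.toLinearMap := by
    rw [Submodule.span_le]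
    rintro _ ⟨i, hi, rfl⟩
    change K (v i) ∈ Submodule.span ℝ (v '' T)
    rw [h.apply_eq i (hT i hi)]
    exact Submodule.smul_mem _ _ (Submodule.subset_span ⟨i, hi, rfl⟩)
  exact this hx

/-- A larger norm on the complement would be attained at an eigenvector there. By completeness that
vector lies in the span of the first eigenvectors, so it is orthogonal to itself. -/
theorem norm_apply_le [CompleteSpace H] (h : IsSpectralSystem K N a v) (hK : IsCompactNonneg K)
    (m : ℕ) {x : H} (hx : ∀ i < m, (i : ℕ∞) < N → ⟪v i, x⟫_ℝ = 0) :
    ‖K x‖ ≤ extend N a m * ‖x‖ := by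
  set T : Set ℕ := {i | i < m ∧ (i : ℕ∞) < N}
  have hmem : x ∈ (Submodule.span ℝ (v '' T))ᗮ := by
    rw [Submodule.mem_orthogonal]
    intro y hy
    have : Submodule.span ℝ (v '' T) ≤ (Submodule.span ℝ {x})ᗮ := by
      rw [Submodule.span_le]
      rintro _ ⟨i, hi, rfl⟩
      exact Submodule.mem_orthogonal_singleton_iff_inner_left.2 (hx i hi.1 hi.2)
    exact Submodule.mem_orthogonal_singleton_iff_inner_left.1 (this hy)
  obtain ⟨M, hM, hle, hex⟩ := hK.exists_bound_orthogonal (Submodule.span ℝ (v '' T))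
    fun y hy => h.apply_mem_span (T := T) (fun i hi => hi.2) hy
  refine (hle x hmem).trans (mul_le_mul_of_nonneg_right ?_ (norm_nonneg x))
  rcases hM.eq_or_lt with h0 | hpos
  · rw [← h0]; exact h.extend_nonneg m
  obtain ⟨u, hu, hu1, hKu⟩ := hex hpos
  have hspan := h.complete M u hpos.ne' hKu
  by_contra! hlt
  have hsub : {i : ℕ | (i : ℕ∞) < N ∧ a i = M} ⊆ T := by
    rintro i ⟨hi, rfl⟩
    refine ⟨?_, hi⟩
    by_contra! hmi
    have := h.anti m i hmi hi
    rw [extend_of_lt (lt_of_le_of_lt (by exact_mod_cast hmi) hi)] at hlt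
    linarith
  have hz := hu u (Submodule.span_mono (Set.image_mono hsub) hspan)
  rw [real_inner_self_eq_norm_sq, hu1] at hz
  norm_num at hz

theorem orthonormal_fin (h : IsSpectralSystem K N a v) {n : ℕ} (hn : (n : ℕ∞) ≤ N) :
    Orthonormal ℝ fun i : Fin n => v i :=
  h.orthonormal.comp (fun i : Fin n => (⟨i, lt_of_lt_of_le (by exact_mod_cast i.2) hn⟩ :
    {i : ℕ // (i : ℕ∞) < N})) fun i j hij => Fin.ext (congrArg Subtype.val hij)

/-- Weyl's inequality. -/
theorem extend_le_add [CompleteSpace H] (h : IsSpectralSystem K N a v) {K' : H →L[ℝ] H}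
    {N' : ℕ∞} {a' : ℕ → ℝ} {v' : ℕ → H} (h' : IsSpectralSystem K' N' a' v')
    (hK' : IsCompactNonneg K') (i : ℕ) : extend N a i ≤ extend N' a' i + ‖K - K'‖ := by
  by_cases hi : (i : ℕ∞) < N
  swap
  · rw [extend, if_neg hi]
    exact add_nonneg (h'.extend_nonneg i) (norm_nonneg _)
  rw [extend_of_lt hi]
  have hi1 : ((i + 1 : ℕ) : ℕ∞) ≤ N := by
    push_cast
    exact Order.add_one_le_of_lt hi
  have horth := h.orthonormal_fin hi1
  let comb : (Fin (i + 1) → ℝ) →ₗ[ℝ] H := Fintype.linearCombination ℝ fun l : Fin (i + 1) => v l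
  have hcomb : ∀ c, comb c = ∑ l, c l • v l := fun c => Fintype.linearCombination_apply ℝ _ c
  -- Dimension count for min-max: some nonzero combination of `i + 1` eigenvectors of `K` is
  -- orthogonal to `i` vectors `v' j`. The values `v' j` with `j ≥ N'` are arbitrary, but
  -- orthogonality to them does no harm.
  let φ : (Fin (i + 1) → ℝ) →ₗ[ℝ] (Fin i → ℝ) :=
    LinearMap.pi fun j => (innerₛₗ ℝ (v' j)) ∘ₗ comb
  obtain ⟨c, hc, hc0⟩ := (Submodule.ne_bot_iff _).1
    (LinearMap.ker_ne_bot_of_finrank_lt (f := φ) (by simp))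
  set x := comb c with hx
  have hxo : ∀ j < i, (j : ℕ∞) < N' → ⟪v' j, x⟫_ℝ = 0 := fun j hj _ =>
    congrFun (LinearMap.mem_ker.1 hc) ⟨j, hj⟩
  have hxx : ‖x‖ ^ 2 = ∑ l, c l * c l := by
    rw [← real_inner_self_eq_norm_sq, hx, hcomb, horth.inner_sum]
    simp
  have hKx : ⟪K x, x⟫_ℝ = ∑ l : Fin (i + 1), a l * (c l * c l) := by
    have : K x = ∑ l : Fin (i + 1), (a l * c l) • v l := by
      rw [hx, hcomb, map_sum]
      refine Finset.sum_congr rfl fun l _ => ?_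
      rw [map_smul, h.apply_eq l (lt_of_lt_of_le (by exact_mod_cast l.2) hi1), smul_smul, mul_comm]
    rw [this, hx, hcomb, horth.inner_sum]
    simp [mul_assoc]
  have h1 : a i * ‖x‖ ^ 2 ≤ ⟪K x, x⟫_ℝ := by
    rw [hKx, hxx, Finset.mul_sum]
    exact Finset.sum_le_sum fun l _ => mul_le_mul_of_nonneg_right
      (h.anti l i (Nat.lt_succ_iff.1 l.2) hi) (mul_self_nonneg _)
  have hxpos : 0 < ‖x‖ ^ 2 := by
    rw [hxx]
    obtain ⟨l, hl⟩ := Function.ne_iff.1 hc0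
    exact Finset.sum_pos' (fun l _ => mul_self_nonneg _)
      ⟨l, Finset.mem_univ _, mul_self_pos.2 hl⟩
  have h2 : ⟪K' x, x⟫_ℝ ≤ extend N' a' i * ‖x‖ ^ 2 := by
    have := real_inner_le_norm (K' x) x
    nlinarith [h'.norm_apply_le hK' i hxo, norm_nonneg x]
  have h3 : ⟪(K - K') x, x⟫_ℝ ≤ ‖K - K'‖ * ‖x‖ ^ 2 := by
    have := real_inner_le_norm ((K - K') x) x
    nlinarith [(K - K').le_opNorm x, norm_nonneg x]
  rw [sub_apply, inner_sub_left] at h3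
  refine le_of_mul_le_mul_right ?_ hxpos
  linarith

theorem abs_extend_sub_le [CompleteSpace H] (h : IsSpectralSystem K N a v)
    (hK : IsCompactNonneg K) {K' : H →L[ℝ] H} {N' : ℕ∞} {a' : ℕ → ℝ} {v' : ℕ → H}
    (h' : IsSpectralSystem K' N' a' v') (hK' : IsCompactNonneg K') (i : ℕ) :
    |extend N a i - extend N' a' i| ≤ ‖K - K'‖ := by
  have h1 := h.extend_le_add h' hK' i
  have h2 := h'.extend_le_add h hK i
  rw [norm_sub_rev] at h2
  rw [abs_le]
  constructor <;> linarith

/-- Take for w the projection of u and put q = u - w. The residual (K - K') u = (K - b) q + (K - b)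
w is an orthogonal sum, and K - b is bounded below by g on the spectral complement. -/
theorem exists_mem_span_norm_sub_le [CompleteSpace H] (h : IsSpectralSystem K N a v)
    (hK : IsCompactNonneg K) {m : ℕ} (hm : (m : ℕ∞) ≤ N) {K' : H →L[ℝ] H} {b : ℝ} {u : H}
    (hu : K' u = b • u) {g : ℝ} (hg : 0 < g) (hgb : g ≤ b - extend N a m) :
    ∃ w ∈ Submodule.span ℝ (v '' Set.Iio m), ‖w‖ ≤ ‖u‖ ∧ ‖u - w‖ ≤ ‖K - K'‖ * ‖u‖ / g := by
  set E := Submodule.span ℝ (v '' Set.Iio m)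
  have : FiniteDimensional ℝ E :=
    FiniteDimensional.span_of_finite ℝ ((Set.finite_Iio m).image v)
  have hE : ∀ x ∈ E, K x ∈ E := fun x hx => h.apply_mem_span
    (fun i hi => lt_of_lt_of_le (by exact_mod_cast (hi : i < m)) hm) hx
  set w := E.starProjection u
  have hw : w ∈ E := E.starProjection_apply_mem u
  have hq : u - w ∈ Eᗮ := E.sub_starProjection_mem_orthogonal u
  refine ⟨w, hw, E.norm_starProjection_apply_le u, ?_⟩
  set q := u - w with hqdef
  have hKq : ‖K q‖ ≤ extend N a m * ‖q‖ := h.norm_apply_le hK m fun i hi _ =>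
    hq _ (Submodule.subset_span ⟨i, hi, rfl⟩)
  have hKqE : K q ∈ Eᗮ := fun y hy => by
    rw [← hK.symm]
    exact hq _ (hE y hy)
  have hdec : (K - K') u = (K q - b • q) + (K w - b • w) := by
    rw [sub_apply, hu, hqdef, map_sub, smul_sub]
    abel
  have hpyth : ‖K q - b • q‖ ≤ ‖(K - K') u‖ := by
    have h0 : ⟪K q - b • q, K w - b • w⟫_ℝ = 0 := by
      rw [real_inner_comm]
      exact (Eᗮ.sub_mem hKqE (Eᗮ.smul_mem b hq)) _ (E.sub_mem (hE w hw) (E.smul_mem b hw))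
    have h1 := norm_add_sq_eq_norm_sq_add_norm_sq_of_inner_eq_zero _ _ h0
    rw [hdec]
    exact abs_le_of_sq_le_sq' (by nlinarith [norm_nonneg (K w - b • w)]) (norm_nonneg _) |>.2
  have hb : 0 ≤ b := by linarith [h.extend_nonneg m]
  have h2 : b * ‖q‖ - ‖K q‖ ≤ ‖K q - b • q‖ := by
    have := norm_sub_norm_le (b • q) (K q)
    rwa [norm_smul, Real.norm_of_nonneg hb, norm_sub_rev (b • q)] at this
  have h3 := (K - K').le_opNorm u
  rw [le_div_iff₀ hg]
  nlinarith [norm_nonneg q]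

theorem _root_.ContinuousLinearMap.norm_apply_sub_apply_le {G : Type*} [NormedAddCommGroup G]
    [NormedSpace ℝ G] {R R' : H →L[ℝ] G} {u w : H} {δ A ρ : ℝ} (hu : ‖u‖ = 1) (hw : ‖u - w‖ ≤ ρ)
    (hδ : ‖R - R'‖ ≤ δ) (hA : ‖R‖ ≤ A) : ‖R' u - R w‖ ≤ δ + A * ρ := by
  have h3 : R' u - R w = R (u - w) - (R - R') u := by
    rw [map_sub, sub_apply]; abel
  have h4 := (R - R').le_opNorm u
  have h5 := R.le_opNorm (u - w)
  have h6 : ‖R‖ * ‖u - w‖ ≤ A * ρ := mul_le_mul hA hw (norm_nonneg _) ((norm_nonneg _).trans hA)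
  rw [hu, mul_one] at h4
  rw [h3]
  linarith [norm_sub_le (R (u - w)) ((R - R') u)]

/-- An eigenvector of `K'` is close to the span of the first eigenvectors of `K`, also in the
graph norm of a linear map `D` such that `D K` and `D K'` are bounded. -/
theorem exists_mem_span_graph_norm_sub_le [CompleteSpace H] {Z : Type*} [NormedAddCommGroup Z]
    [NormedSpace ℝ Z] {V : Submodule ℝ H} {D : V →ₗ[ℝ] Z} {v : ℕ → V}
    (h : IsSpectralSystem K N a fun i => (v i : H)) (hK : IsCompactNonneg K)
    {T : H →L[ℝ] Z} (hT : ∀ (x : H) (y : V), (y : H) = K x → D y = T x)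
    {K' : H →L[ℝ] H} {T' : H →L[ℝ] Z} (hT' : ∀ (x : H) (y : V), (y : H) = K' x → D y = T' x)
    {m : ℕ} (hm : (m : ℕ∞) ≤ N) {b : ℝ} {u : V} (hu1 : ‖(u : H)‖ = 1)
    (hu : K' (u : H) = b • (u : H)) {g : ℝ} (hg : 0 < g) (hgb : g ≤ b - extend N a m)
    {δ A : ℝ} (hδ : ‖K - K'‖ ≤ δ) (hδT : ‖T - T'‖ ≤ δ) (hA : ‖K‖ ≤ A) (hAT : ‖T‖ ≤ A) :
    ∃ y ∈ Submodule.span ℝ (v '' Set.Iio m),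
      ‖((u - y : V) : H)‖ + ‖D (u - y)‖ ≤ 2 * g⁻¹ * (δ + A * (δ / g)) := by
  obtain ⟨w, hw, -, hwu⟩ := h.exists_mem_span_norm_sub_le hK hm hu hg hgb
  have hgb' : g ≤ b := by linarith [h.extend_nonneg m]
  have hb : 0 < b := hg.trans_le hgb'
  have himg : Submodule.span ℝ ((fun i => (v i : H)) '' Set.Iio m)
      = (Submodule.span ℝ (v '' Set.Iio m)).map V.subtype := by
    rw [Submodule.map_span, Set.image_image]
    rfl
  -- The approximant is b⁻¹ K w rather than w. Since b u = K' u, both `D (b • u) = T' u` and `D (K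
  -- w) = T w` are controlled by bounded operators.
  have hKw := h.apply_mem_span (T := Set.Iio m)
    (fun i hi => lt_of_lt_of_le (by exact_mod_cast (hi : i < m)) hm) hw
  rw [himg] at hKw
  obtain ⟨y, hy, hyw⟩ := hKw
  have hyw : (y : H) = K w := hyw
  have hwu' : ‖(u : H) - w‖ ≤ δ / g := by
    refine hwu.trans ?_
    rw [hu1, mul_one]
    gcongr
  have hDy : D y = T w := hT w y hyw
  have hDu : D (b • u) = T' u := hT' _ _ (by rw [Submodule.coe_smul, hu])
  have key : b • (u - b⁻¹ • y) = b • u - y := by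
    rw [smul_sub, smul_inv_smul₀ hb.ne']
  have h1 : b * ‖((u - b⁻¹ • y : V) : H)‖ ≤ δ + A * (δ / g) := by
    rw [← Real.norm_of_nonneg hb.le, ← norm_smul, Real.norm_of_nonneg hb.le, ← Submodule.coe_smul,
      key, Submodule.coe_sub, Submodule.coe_smul, ← hu, hyw]
    exact ContinuousLinearMap.norm_apply_sub_apply_le hu1 hwu' hδ hA
  have h2 : b * ‖D (u - b⁻¹ • y)‖ ≤ δ + A * (δ / g) := by
    rw [← Real.norm_of_nonneg hb.le, ← norm_smul, Real.norm_of_nonneg hb.le, ← map_smul,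
      key, map_sub, hDu, hDy]
    exact ContinuousLinearMap.norm_apply_sub_apply_le hu1 hwu' hδT hAT
  refine ⟨b⁻¹ • y, Submodule.smul_mem _ _ hy, ?_⟩
  have h3 : g * (‖((u - b⁻¹ • y : V) : H)‖ + ‖D (u - b⁻¹ • y)‖) ≤ 2 * (δ + A * (δ / g)) := by
    have := mul_le_mul_of_nonneg_right hgb'
      (add_nonneg (norm_nonneg ((u - b⁻¹ • y : V) : H)) (norm_nonneg (D (u - b⁻¹ • y))))
    linarith
  rw [mul_comm 2, mul_assoc]
  rwa [← div_eq_inv_mul, le_div_iff₀' hg]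

/-- Orthonormality in `H` bounds each coefficient of `u` by 1, so approximating the basis vectors
costs only the factor `m`. -/
theorem exists_mem_graph_norm_sub_le_of_mem_span {Z : Type*} [NormedAddCommGroup Z]
    [NormedSpace ℝ Z] {V : Submodule ℝ H} {D : V →ₗ[ℝ] Z} {v : ℕ → V}
    (h : IsSpectralSystem K N a fun i => (v i : H)) {m : ℕ} (hm : (m : ℕ∞) ≤ N)
    {E : Submodule ℝ V} {η : ℝ}
    (hE : ∀ i < m, ∃ y ∈ E, ‖((v i - y : V) : H)‖ + ‖D (v i - y)‖ ≤ η)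
    {u : V} (hu : u ∈ Submodule.span ℝ (v '' Set.Iio m)) (hu1 : ‖(u : H)‖ ≤ 1) :
    ∃ y ∈ E, ‖((u - y : V) : H)‖ + ‖D (u - y)‖ ≤ m * η := by
  have hrange : v '' Set.Iio m = Set.range fun i : Fin m => v i := by
    ext x
    constructor
    · rintro ⟨i, hi, rfl⟩
      exact ⟨⟨i, hi⟩, rfl⟩
    · rintro ⟨i, rfl⟩
      exact ⟨i, i.2, rfl⟩
  rw [hrange, Submodule.mem_span_range_iff_exists_fun] at hu
  obtain ⟨c, rfl⟩ := hu
  have horth := h.orthonormal_fin hm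
  have hc : ∀ i, |c i| ≤ 1 := by
    intro i
    have h1 := horth.inner_right_fintype c i
    have h2 := abs_real_inner_le_norm (v i : H) ((∑ i, c i • v i : V) : H)
    rw [Submodule.coe_sum] at h2 hu1
    simp only [Submodule.coe_smul] at h2 hu1
    rw [h1, horth.1 i, one_mul] at h2
    exact h2.trans hu1
  choose! y hy hyη using hE
  refine ⟨∑ i : Fin m, c i • y i, Submodule.sum_mem _ fun i _ => E.smul_mem _ (hy i i.2), ?_⟩
  have hsub : (∑ i : Fin m, c i • v i) - ∑ i : Fin m, c i • y i
      = ∑ i : Fin m, c i • (v i - y i) := by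
    rw [← Finset.sum_sub_distrib]
    exact Finset.sum_congr rfl fun i _ => (smul_sub _ _ _).symm
  rw [hsub, map_sum, Submodule.coe_sum]
  calc ‖∑ i : Fin m, ((c i • (v i - y i) : V) : H)‖ + ‖∑ i : Fin m, D (c i • (v i - y i))‖
      ≤ (∑ i : Fin m, ‖((c i • (v i - y i) : V) : H)‖) + ∑ i : Fin m, ‖D (c i • (v i - y i))‖ :=
        add_le_add (norm_sum_le _ _) (norm_sum_le _ _)
    _ = ∑ i : Fin m, |c i| * (‖((v i - y i : V) : H)‖ + ‖D (v i - y i)‖) := by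
        rw [← Finset.sum_add_distrib]
        refine Finset.sum_congr rfl fun i _ => ?_
        rw [Submodule.coe_smul, map_smul, norm_smul, norm_smul, Real.norm_eq_abs, mul_add]
    _ ≤ ∑ _i : Fin m, η := Finset.sum_le_sum fun i _ => by
        have h1 := hyη i i.2
        have h2 : 0 ≤ ‖((v i - y i : V) : H)‖ + ‖D (v i - y i)‖ := by positivity
        nlinarith [hc i, abs_nonneg (c i)]
    _ = m * η := by simp

end IsSpectralSystem

end Spectral

/-! ### Gaps, and the limit h → 0 as a filter on `S`. -/

theorem subspaceGap_le {X : Type*} [AddCommGroup X] [Module ℝ X] {nrm : X → ℝ}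
    (hnrm : ∀ x, 0 ≤ nrm x) {E F : Submodule ℝ X} {ε : ℝ} (hε : 0 ≤ ε)
    (hE : ∀ u ∈ E, nrm u = 1 → ∃ v ∈ F, nrm (u - v) ≤ ε)
    (hF : ∀ v ∈ F, nrm v = 1 → ∃ u ∈ E, nrm (u - v) ≤ ε) : subspaceGap nrm E F ≤ ε := by
  refine max_le (Real.sSup_le ?_ hε) (Real.sSup_le ?_ hε)
  · rintro _ ⟨u, hu, hu1, rfl⟩
    obtain ⟨v, hv, hle⟩ := hE u hu hu1
    refine le_trans (csInf_le ?_ ?_) hle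
    swap
    · exact ⟨v, hv, rfl⟩
    refine ⟨0, ?_⟩
    rintro _ ⟨w, -, rfl⟩
    exact hnrm _
  · rintro _ ⟨v, hv, hv1, rfl⟩
    obtain ⟨u, hu, hle⟩ := hF v hv hv1
    refine le_trans (csInf_le ?_ ?_) hle
    swap
    · exact ⟨u, hu, rfl⟩
    refine ⟨0, ?_⟩
    rintro _ ⟨w, -, rfl⟩
    exact hnrm _

theorem eventually_comap_nhdsGT_zero_iff {S : Set ℝ} (hS : ∀ h ∈ S, 0 < h) {p : S → Prop} :
    (∀ᶠ h in comap ((↑) : S → ℝ) (𝓝[>] 0), p h) ↔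
      ∃ h₀ > (0 : ℝ), ∀ h : S, (h : ℝ) ≤ h₀ → p h := by
  rw [eventually_comap]
  constructor
  · intro h
    obtain ⟨h₀, hpos, hsub⟩ := mem_nhdsGT_iff_exists_Ioc_subset.1 h
    exact ⟨h₀, hpos, fun x hx => hsub ⟨hS x x.2, hx⟩ x rfl⟩
  · rintro ⟨h₀, hpos, h⟩
    refine mem_nhdsGT_iff_exists_Ioc_subset.2 ⟨h₀, hpos, ?_⟩
    rintro _ ⟨-, hx⟩ y rfl
    exact h y hx

/-! ### The solution operator of the Hodge Laplacian. -/

namespace HilbertComplex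

variable {W : ℤ → Type*} [∀ k, NormedAddCommGroup (W k)] [∀ k, InnerProductSpace ℝ (W k)]
  [∀ k, CompleteSpace (W k)] {C : HilbertComplex W} {k : ℤ}

theorem dV_dV (x : C.V k) : C.dV (k + 1) (C.dV k x) = 0 :=
  Subtype.ext (C.d_d k x)

theorem norm_le_vNorm (u : C.V k) : ‖(u : W k)‖ ≤ C.vNorm k u :=
  Real.le_sqrt_of_sq_le (le_add_of_nonneg_right (sq_nonneg _))

theorem norm_dV_le_vNorm (u : C.V k) : ‖(C.dV k u : W (k + 1))‖ ≤ C.vNorm k u :=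
  Real.le_sqrt_of_sq_le (le_add_of_nonneg_left (sq_nonneg _))

theorem vNorm_le (u : C.V k) : C.vNorm k u ≤ ‖(u : W k)‖ + ‖(C.dV k u : W (k + 1))‖ := by
  refine Real.sqrt_le_iff.2 ⟨by positivity, ?_⟩
  nlinarith [norm_nonneg (u : W k), norm_nonneg (C.dV k u : W (k + 1))]

/-- The solution operator of the source problem for the Hodge Laplacian, in terms of the
pseudoinverses of the differentials. -/
noncomputable def hodgeSolution (L₀ : W (k + 1) →L[ℝ] W k) (L₁ : W (k + 1 + 1) →L[ℝ] W (k + 1)) :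
    W (k + 1) →L[ℝ] W (k + 1) :=
  L₀.adjoint ∘L L₀ + L₁ ∘L L₁.adjoint

theorem hodgeSolution_apply (L₀ : W (k + 1) →L[ℝ] W k) (L₁ : W (k + 1 + 1) →L[ℝ] W (k + 1))
    (x : W (k + 1)) : hodgeSolution L₀ L₁ x = L₀.adjoint (L₀ x) + L₁ (L₁.adjoint x) := rfl

theorem inner_hodgeSolution (L₀ : W (k + 1) →L[ℝ] W k) (L₁ : W (k + 1 + 1) →L[ℝ] W (k + 1))
    (x y : W (k + 1)) : ⟪hodgeSolution L₀ L₁ x, y⟫_ℝ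
      = ⟪L₀ x, L₀ y⟫_ℝ + ⟪L₁.adjoint x, L₁.adjoint y⟫_ℝ := by
  rw [hodgeSolution_apply, inner_add_left, ContinuousLinearMap.adjoint_inner_left,
    ContinuousLinearMap.adjoint_inner_right]

theorem isCompactNonneg_hodgeSolution {L₀ : W (k + 1) →L[ℝ] W k}
    {L₁ : W (k + 1 + 1) →L[ℝ] W (k + 1)} (h₀ : IsCompactOperator L₀) (h₁ : IsCompactOperator L₁) :
    IsCompactNonneg (hodgeSolution L₀ L₁) where
  compact := (h₀.clm_comp L₀.adjoint).add (h₁.comp_clm L₁.adjoint)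
  symm x y := by
    rw [real_inner_comm (hodgeSolution L₀ L₁ y) x, inner_hodgeSolution, inner_hodgeSolution,
      real_inner_comm (L₀ x) (L₀ y), real_inner_comm (L₁.adjoint x) (L₁.adjoint y)]
  nonneg x := by
    rw [inner_hodgeSolution]
    exact add_nonneg real_inner_self_nonneg real_inner_self_nonneg

theorem tendsto_norm_hodgeSolution_sub {ι : Type*} {l : Filter ι} {L₀ : W (k + 1) →L[ℝ] W k}
    {L₁ : W (k + 1 + 1) →L[ℝ] W (k + 1)} {M₀ : ι → W (k + 1) →L[ℝ] W k}
    {M₁ : ι → W (k + 1 + 1) →L[ℝ] W (k + 1)}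
    (h₀ : Tendsto (fun i => ‖M₀ i - L₀‖) l (𝓝 0)) (h₁ : Tendsto (fun i => ‖M₁ i - L₁‖) l (𝓝 0)) :
    Tendsto (fun i => ‖hodgeSolution L₀ L₁ - hodgeSolution (M₀ i) (M₁ i)‖) l (𝓝 0) ∧
      Tendsto (fun i => ‖L₁.adjoint - (M₁ i).adjoint‖) l (𝓝 0) := by
  have t₀ : Tendsto M₀ l (𝓝 L₀) := tendsto_iff_norm_sub_tendsto_zero.2 h₀
  have t₁ : Tendsto M₁ l (𝓝 L₁) := tendsto_iff_norm_sub_tendsto_zero.2 h₁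
  have a₀ : Tendsto (fun i => (M₀ i).adjoint) l (𝓝 L₀.adjoint) :=
    (ContinuousLinearMap.adjoint.continuous.tendsto L₀).comp t₀
  have a₁ : Tendsto (fun i => (M₁ i).adjoint) l (𝓝 L₁.adjoint) :=
    (ContinuousLinearMap.adjoint.continuous.tendsto L₁).comp t₁
  have tK : Tendsto (fun i => hodgeSolution (M₀ i) (M₁ i)) l (𝓝 (hodgeSolution L₀ L₁)) :=
    
    (((continuous_fst.clm_comp continuous_snd).tendsto (L₀.adjoint, L₀)).comp
      (a₀.prodMk_nhds t₀)).add
    (((continuous_fst.clm_comp continuous_snd).tendsto (L₁, L₁.adjoint)).comp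
      (t₁.prodMk_nhds a₁))
  refine ⟨?_, ?_⟩
  · simpa only [norm_sub_rev] using tendsto_iff_norm_sub_tendsto_zero.1 tK
  · simpa only [norm_sub_rev] using tendsto_iff_norm_sub_tendsto_zero.1 a₁

/-- `L` is the pseudoinverse of the differential of the subcomplex `U` in degree `k`. -/
abbrev Subcomplex.IsPseudoinverse (U : C.Subcomplex) (k : ℤ) (L : W (k + 1) →L[ℝ] W k) : Prop :=
  _root_.IsPseudoinverse (C.d k).toFun (U.space k) L

/-! ### Eigenpairs of the mixed problem as eigenvectors of the solution operator. -/

namespace Subcomplex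

variable {U : C.Subcomplex} {L₀ : W (k + 1) →L[ℝ] W k} {L₁ : W (k + 1 + 1) →L[ℝ] W (k + 1)}

theorem exists_dV_eq_adjoint {L : W (k + 1) →L[ℝ] W k} (hL : U.IsPseudoinverse k L) (x : W k) :
    ∃ w ∈ U.space k, (C.dV k w : W (k + 1)) = L.adjoint x :=
  hL.exists_map_eq_adjoint x

theorem exists_mem_eq_apply_adjoint {L : W (k + 1) →L[ℝ] W k} (hL : U.IsPseudoinverse k L)
    (x : W k) : ∃ s ∈ U.space k, (s : W k) = L (L.adjoint x) ∧
      (C.dV k s : W (k + 1)) = L.adjoint x := by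
  obtain ⟨w, hw, hw'⟩ := hL.exists_map_eq_adjoint x
  obtain ⟨s, hs, hs', hDs⟩ := hL.exists_apply_map hw
  exact ⟨s, hs, hs'.trans (by rw [hw']), hDs.trans hw'⟩

/-- L₀* L₀ x is a coboundary and L₁ L₁* x is a preimage of L₁* x under d, whence d K = L₁*. This
identity carries the estimates over to the graph norm. -/
theorem exists_mem_eq_hodgeSolution (h₀ : U.IsPseudoinverse k L₀)
    (h₁ : U.IsPseudoinverse (k + 1) L₁) (x : W (k + 1)) :
    ∃ y ∈ U.space (k + 1), (y : W (k + 1)) = hodgeSolution L₀ L₁ x ∧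
      (C.dV (k + 1) y : W (k + 1 + 1)) = L₁.adjoint x := by
  obtain ⟨w, hw, hw'⟩ := exists_dV_eq_adjoint h₀ (L₀ x)
  obtain ⟨s, hs, hs', hDs⟩ := exists_mem_eq_apply_adjoint h₁ x
  refine ⟨C.dV k w + s, Submodule.add_mem _ (U.map_mem k w hw) hs, ?_, ?_⟩
  · rw [Submodule.coe_add, hw', hs', hodgeSolution_apply]
  · rw [map_add, dV_dV, zero_add, hDs]

theorem dV_eq_of_eq_hodgeSolution (h₀ : U.IsPseudoinverse k L₀)
    (h₁ : U.IsPseudoinverse (k + 1) L₁) (x : W (k + 1)) (y : C.V (k + 1))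
    (hy : (y : W (k + 1)) = hodgeSolution L₀ L₁ x) :
    (C.d (k + 1)).toFun y = L₁.adjoint x := by
  obtain ⟨z, -, hz, hDz⟩ := exists_mem_eq_hodgeSolution h₀ h₁ x
  rw [show y = z from Subtype.ext (hy.trans hz.symm)]
  exact hDz

theorem inner_dV_apply (h₁ : U.IsPseudoinverse (k + 1) L₁) {τ : C.V k} (hτ : τ ∈ U.space k)
    (x : W (k + 1 + 1)) : ⟪(C.dV k τ : W (k + 1)), L₁ x⟫_ℝ = 0 :=
  h₁.inner_ker (U.map_mem k τ hτ) (congrArg Subtype.val (dV_dV τ)) x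

/-- Testing with p gives p = 0. The equations then say σ = λ L₀ u and du = λ L₁* u, so u - λ K u is
harmonic. It is also orthogonal to u and K u, hence zero. -/
theorem IsEigenpair.ne_zero_and_hodgeSolution_eq (h₀ : U.IsPseudoinverse k L₀)
    (h₁ : U.IsPseudoinverse (k + 1) L₁) {lam : ℝ} {u : C.V (k + 1)} (h : U.IsEigenpair k lam u) :
    lam ≠ 0 ∧ hodgeSolution L₀ L₁ u = lam⁻¹ • (u : W (k + 1)) := by
  obtain ⟨hu, hu0, σ, hσ, p, hp, e1, e2, e3⟩ := h
  have hp0 : p = 0 := by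
    have h1 := e2 p hp.1
    rw [hp.2.2 σ hσ, hp.2.1, e3 p hp, Submodule.coe_zero, inner_zero_right, mul_zero, zero_add,
      zero_add, inner_self_eq_zero] at h1
    exact Subtype.ext h1
  simp only [hp0, Submodule.coe_zero, inner_zero_right, add_zero] at e2
  have hlam : lam ≠ 0 := by
    rintro rfl
    have h1 := e2 u hu
    have h2 := e1 σ hσ
    rw [zero_mul] at h1
    have h3 : ⟪(σ : W k), (σ : W k)⟫_ℝ
        + ⟪(C.dV (k + 1) u : W (k + 1 + 1)), (C.dV (k + 1) u : W (k + 1 + 1))⟫_ℝ = 0 := by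
      linarith
    obtain ⟨h4, h5⟩ := (add_eq_zero_iff_of_nonneg real_inner_self_nonneg
      real_inner_self_nonneg).1 h3
    rw [inner_self_eq_zero] at h4 h5
    have hharm : u ∈ U.harmonic k := by
      refine ⟨hu, Subtype.ext h5, fun τ hτ => ?_⟩
      have := e1 τ hτ
      rw [h4, inner_zero_left] at this
      linarith
    exact hu0 (Subtype.ext (inner_self_eq_zero.1 (e3 u hharm)))
  refine ⟨hlam, ?_⟩
  have hσL : (σ : W k) = lam • L₀ u := by
    rw [← map_smul]
    refine h₀.eq_of_isMinimalSolution ⟨hσ, fun z hz hDz => ?_, fun x hx => ?_⟩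
    · have := e1 z hz
      rw [show (C.dV k z : W (k + 1)) = 0 from hDz, inner_zero_left, sub_zero] at this
      rw [real_inner_comm, this]
    · have := e2 _ (U.map_mem k x hx)
      rw [dV_dV, Submodule.coe_zero, inner_zero_right, add_zero] at this
      rw [inner_sub_right, inner_smul_right, sub_eq_zero, real_inner_comm (u : W (k + 1)),
        real_inner_comm ((C.d k).toFun σ)]
      exact this.symm
  have hd : (C.dV (k + 1) u : W (k + 1 + 1)) = lam • L₁.adjoint u := by
    refine ext_inner_right ℝ fun z => ?_
    obtain ⟨s, hs, hs'⟩ := h₁ z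
    have h2 := e2 s hs'.mem
    have h3 := hs'.orthogonal_range u hu
    have h4 := inner_dV_apply h₁ hσ z
    rw [inner_sub_right, sub_eq_zero] at h3
    rw [inner_smul_left, ContinuousLinearMap.adjoint_inner_left, ← hs]
    rw [← hs] at h4
    rw [h4, zero_add] at h2
    exact h3.trans h2
  obtain ⟨w, hw, hw'⟩ := exists_dV_eq_adjoint h₀ (L₀ u)
  obtain ⟨y, hy, hyK, hDy⟩ := exists_mem_eq_hodgeSolution h₀ h₁ u
  set q := u - lam • y with hq
  have hqh : q ∈ U.harmonic k := by
    refine ⟨Submodule.sub_mem _ hu (Submodule.smul_mem _ _ hy), ?_, fun τ hτ => ?_⟩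
    · refine Subtype.ext ?_
      rw [hq, map_sub, map_smul, Submodule.coe_sub, Submodule.coe_smul, hDy, hd, sub_self,
        Submodule.coe_zero]
    · have h1 := e1 τ hτ
      rw [hq, Submodule.coe_sub, Submodule.coe_smul, hyK, inner_sub_right, inner_smul_right,
        hodgeSolution_apply, inner_add_right, inner_dV_apply h₁ hτ, add_zero,
        ContinuousLinearMap.adjoint_inner_right]
      have h2 := h₀.inner_apply_map hτ (u : W (k + 1))
      rw [show (C.d k).toFun τ = (C.dV k τ : W (k + 1)) from rfl] at h2
      rw [hσL, inner_smul_left, real_inner_comm, ← h2] at h1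
      simp only [conj_trivial] at h1
      linarith
  have hqq : ⟪(q : W (k + 1)), (q : W (k + 1))⟫_ℝ = 0 := by
    have hqz : ∀ z, ⟪(q : W (k + 1)), z⟫_ℝ
        = ⟪(u : W (k + 1)), z⟫_ℝ - lam * ⟪hodgeSolution L₀ L₁ u, z⟫_ℝ := fun z => by
      rw [hq, Submodule.coe_sub, Submodule.coe_smul, hyK, inner_sub_left, inner_smul_left]
      simp
    have h5 : ⟪L₁ (L₁.adjoint u), (q : W (k + 1))⟫_ℝ = 0 := by
      rw [real_inner_comm]
      exact h₁.inner_ker hqh.1 (congrArg Subtype.val hqh.2.1) _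
    rw [hqz, e3 q hqh, hodgeSolution_apply, inner_add_left, ← hw', hqh.2.2 w hw, h5]
    simp
  have hq0 : (q : W (k + 1)) = 0 := inner_self_eq_zero.1 hqq
  rw [hq, Submodule.coe_sub, Submodule.coe_smul, hyK, sub_eq_zero] at hq0
  rw [eq_inv_smul_iff₀ hlam, ← hq0]

theorem isEigenpair_of_hodgeSolution_eq (h₀ : U.IsPseudoinverse k L₀)
    (h₁ : U.IsPseudoinverse (k + 1) L₁) {lam : ℝ} {u : C.V (k + 1)} (hlam : lam ≠ 0) (hu0 : u ≠ 0)
    (h : hodgeSolution L₀ L₁ u = lam⁻¹ • (u : W (k + 1))) : U.IsEigenpair k lam u := by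
  obtain ⟨y, hy, hyK, hDy⟩ := exists_mem_eq_hodgeSolution h₀ h₁ u
  obtain ⟨s, hs, hs'⟩ := h₀ (u : W (k + 1))
  obtain ⟨w, hw, hw'⟩ := exists_dV_eq_adjoint h₀ (L₀ u)
  have huy : u = lam • y := by
    refine Subtype.ext ?_
    rw [Submodule.coe_smul, hyK, h, smul_inv_smul₀ hlam]
  -- This is the Hodge decomposition of u, without harmonic part. It dictates σ = λ L₀ u and p = 0.
  have hsplit : (u : W (k + 1)) = lam • (C.dV k w : W (k + 1)) + lam • L₁ (L₁.adjoint u) := by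
    conv_lhs => rw [huy]
    rw [Submodule.coe_smul, hyK, hodgeSolution_apply, smul_add, hw']
  have hDs : (C.dV k s : W (k + 1)) = lam • (C.dV k w : W (k + 1)) := by
    have hmem : s - lam • w ∈ U.space k := Submodule.sub_mem _ hs'.mem (Submodule.smul_mem _ _ hw)
    have h1 := hs'.orthogonal_range _ hmem
    have h2 := inner_dV_apply h₁ hmem (lam • L₁.adjoint u)
    have h3 : (u : W (k + 1)) - (C.dV k s : W (k + 1))
        = L₁ (lam • L₁.adjoint u) - (C.dV k (s - lam • w) : W (k + 1)) := by
      conv_lhs => rw [hsplit]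
      rw [map_smul, map_sub, map_smul, Submodule.coe_sub, Submodule.coe_smul]
      abel
    change ⟪(C.dV k (s - lam • w) : W (k + 1)), (u : W (k + 1)) - (C.dV k s : W (k + 1))⟫_ℝ = 0
      at h1
    rw [h3, inner_sub_right, h2, zero_sub, neg_eq_zero, inner_self_eq_zero, map_sub, map_smul,
      Submodule.coe_sub, Submodule.coe_smul, sub_eq_zero] at h1
    exact h1
  refine ⟨huy ▸ Submodule.smul_mem _ _ hy, hu0, lam • s, Submodule.smul_mem _ _ hs'.mem, 0,
    ⟨Submodule.zero_mem _, map_zero _, fun τ _ => by simp⟩, fun τ hτ => ?_, fun v hv => ?_,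
    fun q hq => ?_⟩
  · have h1 : ⟪(C.dV k τ : W (k + 1)), (u : W (k + 1))⟫_ℝ = lam * ⟪(τ : W k), L₀ u⟫_ℝ := by
      conv_lhs => rw [hsplit]
      rw [inner_add_right, inner_smul_right, inner_smul_right, inner_dV_apply h₁ hτ, hw',
        ContinuousLinearMap.adjoint_inner_right, mul_zero, add_zero]
      exact congrArg _ (h₀.inner_apply_map hτ _)
    rw [h1, Submodule.coe_smul, inner_smul_left, hs, real_inner_comm]
    simp
  -- Split v into r = L₁ dv and the cocycle v - r. Pairing λ u with r gives ⟨du, dv⟩, and pairing it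
  -- with v - r gives ⟨dσ, v⟩.
  · obtain ⟨r, hr, hrL, hDr⟩ := h₁.exists_apply_map hv
    have hker : (C.d (k + 1)).toFun (v - r) = 0 := by rw [map_sub, hDr, sub_self]
    have hdu : (C.dV (k + 1) u : W (k + 1 + 1)) = lam • L₁.adjoint u := by
      conv_lhs => rw [huy]
      rw [map_smul, Submodule.coe_smul, hDy]
    have h1 : ⟪L₁.adjoint u, (C.dV (k + 1) v : W (k + 1 + 1))⟫_ℝ = ⟪(u : W (k + 1)), r⟫_ℝ := by
      rw [ContinuousLinearMap.adjoint_inner_left, hrL]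
      rfl
    have h2 : ⟪(C.dV k w : W (k + 1)), (r : W (k + 1))⟫_ℝ = 0 := by
      rw [hrL]; exact inner_dV_apply h₁ hw _
    have h3 : ⟪(u : W (k + 1)), ((v - r : C.V (k + 1)) : W (k + 1))⟫_ℝ
        = lam * ⟪(C.dV k w : W (k + 1)), (v : W (k + 1))⟫_ℝ := by
      conv_lhs => rw [hsplit]
      rw [inner_add_left, inner_smul_left, inner_smul_left,
        real_inner_comm _ (L₁ _), h₁.inner_ker (Submodule.sub_mem _ hv hr) hker,
        Submodule.coe_sub, inner_sub_right, h2]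
      simp
    rw [Submodule.coe_sub, inner_sub_right] at h3
    rw [Submodule.coe_zero, inner_zero_right, add_zero, map_smul, Submodule.coe_smul, hDs, hdu,
      inner_smul_left, inner_smul_left, inner_smul_left, h1]
    simp only [conj_trivial]
    rw [← h3]
    ring
  · rw [hsplit, inner_add_left, inner_smul_left, inner_smul_left, hq.2.2 w hw,
      real_inner_comm _ (L₁ _), h₁.inner_ker hq.1 (congrArg Subtype.val hq.2.1)]
    simp

theorem IsEigensystem.isSpectralSystem (h₀ : U.IsPseudoinverse k L₀)
    (h₁ : U.IsPseudoinverse (k + 1) L₁) {N : ℕ∞} {ev : ℕ → ℝ} {v : ℕ → C.V (k + 1)}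
    (h : U.IsEigensystem k N ev v) :
    IsSpectralSystem (hodgeSolution L₀ L₁) N (fun i => (ev i)⁻¹) fun i => (v i : W (k + 1)) := by
  have hpos : ∀ i : ℕ, (i : ℕ∞) < N → 0 < ev i := by
    intro i hi
    obtain ⟨hne, heq⟩ := (h.isEigenpair i hi).ne_zero_and_hodgeSolution_eq h₀ h₁
    have h1 : 0 ≤ ⟪hodgeSolution L₀ L₁ (v i : W (k + 1)), (v i : W (k + 1))⟫_ℝ := by
      rw [inner_hodgeSolution]
      exact add_nonneg real_inner_self_nonneg real_inner_self_nonneg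
    rw [heq, inner_smul_left, real_inner_self_eq_norm_sq, h.orthonormal.1 ⟨i, hi⟩] at h1
    have h2 : 0 ≤ ev i := by simpa using h1
    exact lt_of_le_of_ne h2 hne.symm
  refine ⟨fun i hi => ((h.isEigenpair i hi).ne_zero_and_hodgeSolution_eq h₀ h₁).2,
    fun i hi => inv_pos.2 (hpos i hi), fun i j hij hj => ?_, h.orthonormal, fun μ u hμ hu => ?_⟩
  · exact inv_anti₀ (hpos i (lt_of_le_of_lt (by exact_mod_cast hij) hj)) (h.mono i j hij hj)
  · rcases eq_or_ne u 0 with rfl | hu0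
    · exact Submodule.zero_mem _
    obtain ⟨y, -, hy, -⟩ := exists_mem_eq_hodgeSolution h₀ h₁ u
    have huy : u = ((μ⁻¹ • y : C.V (k + 1)) : W (k + 1)) := by
      rw [Submodule.coe_smul, hy, hu, inv_smul_smul₀ hμ]
    have hpair : U.IsEigenpair k μ⁻¹ (μ⁻¹ • y) := by
      refine isEigenpair_of_hodgeSolution_eq h₀ h₁ (inv_ne_zero hμ) (fun h0 => hu0 ?_) ?_
      · rw [huy, h0, Submodule.coe_zero]
      · rw [← huy, inv_inv, hu]
    have hspan := Submodule.mem_map_of_mem (f := (C.V (k + 1)).subtype)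
      (h.multiplicity _ _ hpair)
    rw [Submodule.map_span, Set.image_image] at hspan
    rw [huy]
    refine Submodule.span_mono (Set.image_mono ?_) hspan
    rintro i ⟨hi, hev⟩
    exact ⟨hi, by rw [hev, inv_inv]⟩

theorem exists_isEigensystem (h₀ : U.IsPseudoinverse k L₀) (h₁ : U.IsPseudoinverse (k + 1) L₁)
    (hc₀ : IsCompactOperator L₀) (hc₁ : IsCompactOperator L₁) :
    ∃ N ev v, U.IsEigensystem k N ev v := by
  obtain ⟨N, a, v, h⟩ := (isCompactNonneg_hodgeSolution hc₀ hc₁).exists_isSpectralSystem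
  have hlift : ∀ i : ℕ, ∃ y : C.V (k + 1), (i : ℕ∞) < N → (y : W (k + 1)) = v i := by
    intro i
    by_cases hi : (i : ℕ∞) < N
    · obtain ⟨y, -, hy, -⟩ := exists_mem_eq_hodgeSolution h₀ h₁ (v i)
      refine ⟨(a i)⁻¹ • y, fun _ => ?_⟩
      rw [Submodule.coe_smul, hy, h.apply_eq i hi, inv_smul_smul₀ (h.pos i hi).ne']
    · exact ⟨0, fun hi' => absurd hi' hi⟩
  choose w hw using hlift
  have hcoe : (fun i : {i : ℕ // (i : ℕ∞) < N} => (w i : W (k + 1)))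
      = fun i : {i : ℕ // (i : ℕ∞) < N} => v i := funext fun i => hw i i.2
  have hort : Orthonormal ℝ fun i : {i : ℕ // (i : ℕ∞) < N} => (w i : W (k + 1)) := by
    rw [hcoe]; exact h.orthonormal
  refine ⟨N, fun i => (a i)⁻¹, w, ⟨fun i hi => ?_, fun i j hij hj => ?_, hort, fun lam u hu => ?_⟩⟩
  · refine isEigenpair_of_hodgeSolution_eq h₀ h₁ (inv_ne_zero (h.pos i hi).ne') ?_ ?_
    · intro h0
      have := hort.1 ⟨i, hi⟩
      change ‖(w i : W (k + 1))‖ = 1 at this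
      rw [h0, Submodule.coe_zero, norm_zero] at this
      exact zero_ne_one this
    · rw [hw i hi, h.apply_eq i hi, inv_inv]
  · exact inv_anti₀ (h.pos j hj) (h.anti i j hij hj)
  · obtain ⟨hne, heq⟩ := hu.ne_zero_and_hodgeSolution_eq h₀ h₁
    have h2 := h.complete _ _ (inv_ne_zero hne) heq
    have hset : {i : ℕ | (i : ℕ∞) < N ∧ a i = lam⁻¹} = {i : ℕ | (i : ℕ∞) < N ∧ (a i)⁻¹ = lam} := by
      ext i
      exact and_congr_right fun _ => inv_eq_iff_eq_inv.symm
    have himg : v '' {i : ℕ | (i : ℕ∞) < N ∧ a i = lam⁻¹}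
        = (C.V (k + 1)).subtype '' (w '' {i : ℕ | (i : ℕ∞) < N ∧ (a i)⁻¹ = lam}) := by
      rw [Set.image_image, hset]
      exact Set.image_congr fun i hi => (hw i hi.1).symm
    rw [himg, ← Submodule.map_span] at h2
    obtain ⟨z, hz, hzu⟩ := h2
    rwa [← Subtype.ext hzu]

theorem exists_isPseudoinverse_of_finiteDimensional (U : C.Subcomplex) (k : ℤ)
    [FiniteDimensional ℝ (U.space k)] : ∃ L, U.IsPseudoinverse k L := by
  refine exists_isPseudoinverse (C.d k).toFun (U.space k) ?_ ?_
  · exact ((U.space k).map ((C.V k).subtype.prod (C.d k).toFun)).closed_of_finiteDimensional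
  · exact ((U.space k).map (C.d k).toFun).closed_of_finiteDimensional

end Subcomplex

/-! ### Pseudoinverses on the whole complex: existence, compactness, approximation. -/

theorem exists_isPseudoinverse_whole (hC : C.IsClosedComplex) (k : ℤ) :
    ∃ L, C.whole.IsPseudoinverse k L := by
  refine exists_isPseudoinverse (C.d k).toFun ⊤ ?_ ?_
  · have := C.closed k
    rw [LinearPMap.IsClosed] at this
    convert this using 1
    ext p
    rw [SetLike.mem_coe, LinearPMap.mem_graph_iff]
    constructor
    · rintro ⟨x, -, rfl⟩
      exact ⟨x, rfl, rfl⟩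
    · rintro ⟨x, h1, h2⟩
      exact ⟨x, trivial, Prod.ext h1 h2⟩
  · rw [Submodule.map_top]
    exact hC k

theorem isCompactOperator_of_isPseudoinverse_whole (hC : C.CompactnessProperty)
    {L : W (k + 1) →L[ℝ] W k} (hL : C.whole.IsPseudoinverse k L) : IsCompactOperator L := by
  obtain ⟨n, rfl⟩ : ∃ n, k = n + 1 := ⟨k - 1, by ring⟩
  -- For s = L f, orthogonality to cocycles gives d* s = 0, and ‖ds‖ ≤ ‖f‖ since ds is a projection
  -- of f. The squared intersection norm is thus at most R ‖f‖², and the ball of radius R⁻¹ lands in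
  -- the unit ball because R ≥ 1.
  set R := 2 * ‖L‖ ^ 2 + 1 with hR
  have hR1 : 1 ≤ R := by rw [hR]; nlinarith [sq_nonneg ‖L‖]
  have hRpos : 0 < R := by linarith
  refine (isCompactOperator_iff_image_closedBall_subset_compact L.toLinearMap
    (r := R⁻¹) (by positivity)).2 ⟨_, (hC n).2, ?_⟩
  rintro _ ⟨f, hf, rfl⟩
  refine subset_closure ?_
  obtain ⟨s, hs, hs'⟩ := hL f
  change L f ∈ _
  rw [← hs]
  have horth : ∀ x : (C.d n).domain, ⟪(0 : W n), (x : W n)⟫_ℝ = ⟪(s : W (n + 1)), C.d n x⟫_ℝ := by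
    intro x
    rw [inner_zero_left, real_inner_comm]
    exact (hs'.orthogonal_ker (C.dV n x) trivial (congrArg Subtype.val (dV_dV x))).symm
  have hmem : (s : W (n + 1)) ∈ C.Vstar n :=
    LinearPMap.mem_adjoint_domain_of_exists _ ⟨0, horth⟩
  have hadj : (C.d n).adjoint ⟨s, hmem⟩ = 0 :=
    LinearPMap.adjoint_apply_eq (C.dense_domain n) ⟨s, hmem⟩ horth
  refine ⟨s.2, hmem, ?_⟩
  have hf1 : ‖f‖ ≤ R⁻¹ := by simpa using hf
  have hs1 : ‖(s : W (n + 1))‖ ≤ ‖L‖ * R⁻¹ := by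
    rw [hs]
    exact (L.le_opNorm f).trans (by gcongr)
  have hd1 : ‖C.d (n + 1) s‖ ≤ R⁻¹ := by
    refine le_trans ?_ hf1
    change ‖(C.d (n + 1)).toFun s‖ ≤ ‖f‖
    rw [_root_.IsPseudoinverse.map_eq_starProjection hs']
    exact Submodule.norm_starProjection_apply_le _ f
  have h1 : ‖(s : W (n + 1))‖ ^ 2 ≤ (‖L‖ * R⁻¹) ^ 2 := by gcongr
  have h2 : ‖C.d (n + 1) s‖ ^ 2 ≤ R⁻¹ ^ 2 := by gcongr
  rw [hadj, norm_zero]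
  change ‖(s : W (n + 1))‖ ^ 2 + ‖C.d (n + 1) s‖ ^ 2 + (‖(s : W (n + 1))‖ ^ 2 + 0 ^ 2) ≤ 1
  calc _ ≤ R * R⁻¹ ^ 2 := by rw [hR] at *; nlinarith
    _ = R⁻¹ := by field_simp
    _ ≤ 1 := inv_le_one_of_one_le₀ hR1

theorem tendsto_pseudoinverse (hC : C.CompactnessProperty) {S : Set ℝ} (hS : ∀ h ∈ S, 0 < h)
    {U : S → C.Subcomplex} (happrox : C.Approximating U)
    (hproj : C.HasUniformlyBoundedCochainProjections U) {L : W (k + 1) →L[ℝ] W k}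
    (hL : C.whole.IsPseudoinverse k L) {Lh : S → W (k + 1) →L[ℝ] W k}
    (hLh : ∀ h, (U h).IsPseudoinverse k (Lh h)) :
    Tendsto (fun h => ‖Lh h - L‖) (comap ((↑) : S → ℝ) (𝓝[>] 0)) (𝓝 0) := by
  obtain ⟨π, hmem, hid, hcomm, hbdd⟩ := hproj
  obtain ⟨c, hc⟩ := hbdd k
  refine _root_.IsPseudoinverse.tendsto_norm_sub hL (isCompactOperator_of_isPseudoinverse_whole hC hL) hLh
    (fun h => π h k) (fun h v => hmem h k v) (fun h v hv => hid h k v hv) ?_ hc ?_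
  · intro h s hs t hts
    have h1 : C.dV k t = C.dV k s := Subtype.ext hts
    have h2 := hcomm h k t
    rw [h1, hid h (k + 1) _ ((U h).map_mem k s hs)] at h2
    exact congrArg Subtype.val h2
  · intro u ε hε
    rw [eventually_comap_nhdsGT_zero_iff hS]
    obtain ⟨h₀, hpos, hh⟩ := happrox k u ε hε
    refine ⟨h₀, hpos, fun h hle => ?_⟩
    obtain ⟨v, hv, hlt⟩ := hh h hle
    exact ⟨v, hv, (norm_le_vNorm _).trans_lt hlt, (norm_dV_le_vNorm _).trans_lt hlt⟩

theorem norm_and_vNorm_le {x : C.V k} {ε : ℝ}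
    (hx : ‖(x : W k)‖ + ‖(C.d k).toFun x‖ ≤ ε) : ‖(x : W k)‖ ≤ ε ∧ C.vNorm k x ≤ ε :=
  ⟨by linarith [norm_nonneg ((C.d k).toFun x)], (vNorm_le x).trans hx⟩

/-- One hypothesis serves both gaps: a vector of unit V-norm has W-norm at most 1, and the sum norm
dominates both norms. -/
theorem subspaceGap_le_of_graph_norm {E F : Submodule ℝ (C.V k)} {ε : ℝ} (hε : 0 ≤ ε)
    (hE : ∀ u ∈ E, ‖(u : W k)‖ ≤ 1 →
      ∃ y ∈ F, ‖((u - y : C.V k) : W k)‖ + ‖(C.d k).toFun (u - y)‖ ≤ ε)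
    (hF : ∀ u ∈ F, ‖(u : W k)‖ ≤ 1 →
      ∃ y ∈ E, ‖((u - y : C.V k) : W k)‖ + ‖(C.d k).toFun (u - y)‖ ≤ ε) :
    subspaceGap (fun u : C.V k => ‖(u : W k)‖) E F ≤ ε ∧ subspaceGap (C.vNorm k) E F ≤ ε := by
  have hF' : ∀ u ∈ F, ‖(u : W k)‖ ≤ 1 →
      ∃ y ∈ E, ‖((y - u : C.V k) : W k)‖ + ‖(C.d k).toFun (y - u)‖ ≤ ε := by
    intro u hu hu1
    obtain ⟨y, hy, hle⟩ := hF u hu hu1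
    refine ⟨y, hy, ?_⟩
    rw [← neg_sub u y, map_neg, Submodule.coe_neg, norm_neg, norm_neg]
    exact hle
  constructor
  · refine subspaceGap_le (fun _ => norm_nonneg _) hε (fun u hu hu1 => ?_) fun u hu hu1 => ?_
    · obtain ⟨y, hy, hle⟩ := hE u hu hu1.le
      exact ⟨y, hy, (norm_and_vNorm_le hle).1⟩
    · obtain ⟨y, hy, hle⟩ := hF' u hu hu1.le
      exact ⟨y, hy, (norm_and_vNorm_le hle).1⟩
  · refine subspaceGap_le (fun _ => Real.sqrt_nonneg _) hε (fun u hu hu1 => ?_) fun u hu hu1 => ?_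
    · obtain ⟨y, hy, hle⟩ := hE u hu ((norm_le_vNorm u).trans hu1.le)
      exact ⟨y, hy, (norm_and_vNorm_le hle).2⟩
    · obtain ⟨y, hy, hle⟩ := hF' u hu ((norm_le_vNorm u).trans hu1.le)
      exact ⟨y, hy, (norm_and_vNorm_le hle).2⟩

end HilbertComplex

/-! ### Spectral gap and the final estimate. -/

theorem Set.eq_Iio_of_isLowerSet_nat {A : Set ℕ} (hA : IsLowerSet A) (h : A ≠ Set.univ) :
    ∃ m : ℕ, A = Set.Iio m := by
  classical
  have hex : ∃ m, m ∉ A := (Set.ne_univ_iff_exists_notMem A).1 h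
  refine ⟨Nat.find hex, Set.ext fun i => ⟨fun hi => ?_, fun hi => ?_⟩⟩
  · by_contra hle
    exact Nat.find_spec hex (hA (not_lt.1 hle) hi)
  · exact not_not.1 (Nat.find_min hex hi)

theorem abs_inv_sub_inv_le {x y ρ : ℝ} (hρ : 0 < ρ) (hx : ρ ≤ x) (hy : ρ ≤ y) :
    |x⁻¹ - y⁻¹| ≤ (ρ ^ 2)⁻¹ * |x - y| := by
  have hx0 : 0 < x := hρ.trans_le hx
  have hy0 : 0 < y := hρ.trans_le hy
  rw [inv_sub_inv hx0.ne' hy0.ne', abs_div, abs_sub_comm, abs_of_pos (mul_pos hx0 hy0), sq,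
    div_eq_inv_mul]
  gcongr

namespace HilbertComplex

variable {W : ℤ → Type*} [∀ k, NormedAddCommGroup (W k)] [∀ k, InnerProductSpace ℝ (W k)]
  [∀ k, CompleteSpace (W k)] {C : HilbertComplex W} {k : ℤ}

/-- The quantitative form of the convergence of the eigenvalue problems, in terms of the distance
`δ` between the solution operators. -/
theorem eigenvalues_and_gaps_le {U U' : C.Subcomplex} {L₀ M₀ : W (k + 1) →L[ℝ] W k}
    {L₁ M₁ : W (k + 1 + 1) →L[ℝ] W (k + 1)} (hL₀ : U.IsPseudoinverse k L₀)
    (hL₁ : U.IsPseudoinverse (k + 1) L₁) (hM₀ : U'.IsPseudoinverse k M₀)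
    (hM₁ : U'.IsPseudoinverse (k + 1) M₁)
    (hK : IsCompactNonneg (hodgeSolution L₀ L₁)) (hK' : IsCompactNonneg (hodgeSolution M₀ M₁))
    {N N' : ℕ∞} {ev ev' : ℕ → ℝ} {v v' : ℕ → C.V (k + 1)} (hv : U.IsEigensystem k N ev v)
    (hv' : U'.IsEigensystem k N' ev' v') {m : ℕ} (hm : (m : ℕ∞) ≤ N) {ρ g δ A : ℝ} (hg : 0 < g)
    (hρ : ∀ i < m, ρ ≤ (ev i)⁻¹)
    (hgap : IsSpectralSystem.extend N (fun i => (ev i)⁻¹) m + 2 * g ≤ ρ) (hδg : δ ≤ g)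
    (hδ : ‖hodgeSolution L₀ L₁ - hodgeSolution M₀ M₁‖ ≤ δ)
    (hδT : ‖L₁.adjoint - M₁.adjoint‖ ≤ δ) (hA : ‖hodgeSolution L₀ L₁‖ + δ ≤ A)
    (hAT : ‖L₁.adjoint‖ + δ ≤ A) :
    (m : ℕ∞) ≤ N' ∧ (∀ i < m, |ev i - ev' i| ≤ (g ^ 2)⁻¹ * δ) ∧
      subspaceGap (fun u : C.V (k + 1) => ‖(u : W (k + 1))‖)
        (Submodule.span ℝ (v '' Set.Iio m)) (Submodule.span ℝ (v' '' Set.Iio m))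
          ≤ m * (2 * g⁻¹ * (δ + A * (δ / g))) ∧
      subspaceGap (C.vNorm (k + 1))
        (Submodule.span ℝ (v '' Set.Iio m)) (Submodule.span ℝ (v' '' Set.Iio m))
          ≤ m * (2 * g⁻¹ * (δ + A * (δ / g))) := by
  have hs := hv.isSpectralSystem hL₀ hL₁
  have hs' := hv'.isSpectralSystem hM₀ hM₁
  set K := hodgeSolution L₀ L₁
  set K' := hodgeSolution M₀ M₁
  set a : ℕ → ℝ := IsSpectralSystem.extend N fun i => (ev i)⁻¹
  set a' : ℕ → ℝ := IsSpectralSystem.extend N' fun i => (ev' i)⁻¹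
  have hδ0 : 0 ≤ δ := (norm_nonneg _).trans hδ
  have hclose : ∀ i, |a i - a' i| ≤ δ := fun i => (hs.abs_extend_sub_le hK hs' hK' i).trans hδ
  have ha0 : ∀ i, 0 ≤ a i := hs.extend_nonneg
  have hNi : ∀ i < m, (i : ℕ∞) < N := fun i hi => lt_of_lt_of_le (by exact_mod_cast hi) hm
  have hai : ∀ i < m, a i = (ev i)⁻¹ := fun i hi => IsSpectralSystem.extend_of_lt (hNi i hi)
  have hρa : ∀ i < m, a m + 2 * g ≤ a i := fun i hi => by
    rw [hai i hi]; exact hgap.trans (hρ i hi)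
  have hρa' : ∀ i < m, a m + g ≤ a' i := fun i hi => by
    have h1 := hρa i hi
    have h2 := (abs_le.1 (hclose i)).2
    linarith
  -- The perturbed eigenvalues stay positive, whereas the extension is zero from `N'` on; so at
  -- least `m` discrete eigenvalues exist.
  have hNi' : ∀ i < m, (i : ℕ∞) < N' := fun i hi =>
    IsSpectralSystem.lt_of_extend_pos (a := fun i => (ev' i)⁻¹) (by
      have := hρa' i hi
      have := ha0 m
      change 0 < a' i
      linarith)
  have hai' : ∀ i < m, a' i = (ev' i)⁻¹ := fun i hi => IsSpectralSystem.extend_of_lt (hNi' i hi)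
  have hm' : (m : ℕ∞) ≤ N' := by
    by_contra! hlt
    lift N' to ℕ using hlt.ne_top
    exact lt_irrefl _ (hNi' N' (by exact_mod_cast hlt))
  have hnorm : ∀ i < m, ‖(v i : W (k + 1))‖ = 1 := fun i hi => hs.orthonormal.1 ⟨i, hNi i hi⟩
  have hnorm' : ∀ i < m, ‖(v' i : W (k + 1))‖ = 1 := fun i hi =>
    hs'.orthonormal.1 ⟨i, hNi' i hi⟩
  have hT := Subcomplex.dV_eq_of_eq_hodgeSolution hL₀ hL₁
  have hT' := Subcomplex.dV_eq_of_eq_hodgeSolution hM₀ hM₁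
  have hrev : ‖K' - K‖ ≤ δ := by rwa [norm_sub_rev]
  have hrevT : ‖M₁.adjoint - L₁.adjoint‖ ≤ δ := by rwa [norm_sub_rev]
  have hK'A : ‖K'‖ ≤ A := by
    have := norm_add_le (K' - K) K
    rw [sub_add_cancel] at this
    linarith
  have hT'A : ‖M₁.adjoint‖ ≤ A := by
    have := norm_add_le (M₁.adjoint - L₁.adjoint) L₁.adjoint
    rw [sub_add_cancel] at this
    linarith
  have hA0 : 0 ≤ A := (norm_nonneg _).trans hK'A
  refine ⟨hm', fun i hi => ?_, subspaceGap_le_of_graph_norm (by positivity) ?_ ?_⟩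
  -- Both reciprocals are at least g, where inversion has Lipschitz constant g⁻².
  · have h1 := abs_inv_sub_inv_le hg (x := a i) (y := a' i)
      (by linarith [hρa i hi, ha0 m]) (by linarith [hρa' i hi, ha0 m])
    rw [hai i hi, hai' i hi, inv_inv, inv_inv, ← hai i hi, ← hai' i hi] at h1
    exact h1.trans (by gcongr; exact hclose i)
  · intro u hu hu1
    refine hs.exists_mem_graph_norm_sub_le_of_mem_span hm (fun i hi => ?_) hu hu1
    refine hs'.exists_mem_span_graph_norm_sub_le hK' hT' hT hm' (hnorm i hi)
      (hs.apply_eq i (hNi i hi)) hg ?_ hrev hrevT hK'A hT'A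
    -- The gap of 2 g for `a` loses at most δ ≤ g when `a m` is replaced by `a' m`, so g remains in
    -- this direction too.
    have h1 := hρa i hi
    have h2 := (abs_le.1 (hclose m)).1
    rw [hai i hi] at h1
    change g ≤ (ev i)⁻¹ - a' m
    linarith
  · intro u hu hu1
    refine hs'.exists_mem_graph_norm_sub_le_of_mem_span hm' (fun i hi => ?_) hu hu1
    refine hs.exists_mem_span_graph_norm_sub_le hK hT hT' hm (hnorm' i hi)
      (hs'.apply_eq i (hNi' i hi)) hg ?_ hδ hδT (by linarith) (by linarith)
    have h1 := hρa' i hi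
    rw [hai' i hi] at h1
    change g ≤ (ev' i)⁻¹ - a m
    linarith

/-- Only finitely many eigenvalues lie below a given one, and there is a gap above them. -/
theorem Subcomplex.IsEigensystem.exists_spectral_gap {U : C.Subcomplex}
    {L₀ : W (k + 1) →L[ℝ] W k} {L₁ : W (k + 1 + 1) →L[ℝ] W (k + 1)}
    (hL₀ : U.IsPseudoinverse k L₀) (hL₁ : U.IsPseudoinverse (k + 1) L₁)
    (hK : IsCompactNonneg (hodgeSolution L₀ L₁)) {N : ℕ∞} {ev : ℕ → ℝ} {v : ℕ → C.V (k + 1)}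
    (hv : U.IsEigensystem k N ev v) {μ : ℝ} (hμ : 0 < μ) :
    ∃ m : ℕ, {i : ℕ | (i : ℕ∞) < N ∧ ev i ≤ μ} = Set.Iio m ∧ (m : ℕ∞) ≤ N ∧
      (∀ i < m, μ⁻¹ ≤ (ev i)⁻¹) ∧ IsSpectralSystem.extend N (fun i => (ev i)⁻¹) m < μ⁻¹ := by
  have hs := hv.isSpectralSystem hL₀ hL₁
  have hpos : ∀ i : ℕ, (i : ℕ∞) < N → 0 < ev i := fun i hi => inv_pos.1 (hs.pos i hi)
  have hlow : IsLowerSet {i : ℕ | (i : ℕ∞) < N ∧ ev i ≤ μ} := fun j i hij hj =>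
    ⟨lt_of_le_of_lt (by exact_mod_cast hij) hj.1, (hv.mono i j hij hj.1).trans hj.2⟩
  -- Infinitely many eigenvalues at most μ would give an orthonormal sequence with eigenvalues of K
  -- at least μ⁻¹, against compactness.
  obtain ⟨m, hm⟩ := Set.eq_Iio_of_isLowerSet_nat hlow (by
    intro huniv
    have hall : ∀ i : ℕ, (i : ℕ∞) < N ∧ ev i ≤ μ := fun i => Set.eq_univ_iff_forall.1 huniv i
    refine hK.false_of_orthonormal (w := fun i => (v i : W (k + 1))) ?_
      (fun i => hs.apply_eq i (hall i).1) (inv_pos.2 hμ)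
      fun i => inv_anti₀ (hpos i (hall i).1) (hall i).2
    exact hs.orthonormal.comp (fun i : ℕ => (⟨i, (hall i).1⟩ : {i : ℕ // (i : ℕ∞) < N}))
      fun i j hij => congrArg Subtype.val hij)
  have hmem : ∀ i < m, (i : ℕ∞) < N ∧ ev i ≤ μ := fun i hi => (Set.ext_iff.1 hm i).2 hi
  refine ⟨m, hm, ?_, fun i hi => inv_anti₀ (hpos i (hmem i hi).1) (hmem i hi).2, ?_⟩
  · by_contra! hlt
    lift N to ℕ using hlt.ne_top
    exact lt_irrefl _ (hmem N (by exact_mod_cast hlt)).1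
  · by_cases hmN : (m : ℕ∞) < N
    · rw [IsSpectralSystem.extend_of_lt hmN]
      refine inv_strictAnti₀ hμ ?_
      by_contra! hle
      exact lt_irrefl m ((Set.ext_iff.1 hm m).1 ⟨hmN, hle⟩)
    · rw [IsSpectralSystem.extend, if_neg hmN]
      exact inv_pos.2 hμ

theorem eigenvalueProblemsConverge (hclosed : C.IsClosedComplex) (hcompact : C.CompactnessProperty)
    {S : Set ℝ} (hS : ∀ h ∈ S, 0 < h) (U : S → C.Subcomplex)
    (hfin : ∀ h k, FiniteDimensional ℝ ((U h).space k))
    (happrox : C.Approximating U)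
    (hproj : C.HasUniformlyBoundedCochainProjections U) (k : ℤ) :
    C.EigenvalueProblemsConverge U k := by
  obtain ⟨L₀, hL₀⟩ := exists_isPseudoinverse_whole hclosed k
  obtain ⟨L₁, hL₁⟩ := exists_isPseudoinverse_whole hclosed (k + 1)
  have hc₀ := isCompactOperator_of_isPseudoinverse_whole hcompact hL₀
  have hc₁ := isCompactOperator_of_isPseudoinverse_whole hcompact hL₁
  choose M₀ hM₀ using fun h => (U h).exists_isPseudoinverse_of_finiteDimensional k
  choose M₁ hM₁ using fun h => (U h).exists_isPseudoinverse_of_finiteDimensional (k + 1)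
  have hd₀ : ∀ h, IsCompactOperator (M₀ h) := fun h =>
    (hM₀ h).isCompactOperator_of_finiteDimensional
  have hd₁ : ∀ h, IsCompactOperator (M₁ h) := fun h =>
    (hM₁ h).isCompactOperator_of_finiteDimensional
  have hK := isCompactNonneg_hodgeSolution hc₀ hc₁
  obtain ⟨hlimK, hlimT⟩ := tendsto_norm_hodgeSolution_sub
    (tendsto_pseudoinverse hcompact hS happrox hproj hL₀ hM₀)
    (tendsto_pseudoinverse hcompact hS happrox hproj hL₁ hM₁)
  refine ⟨Subcomplex.exists_isEigensystem hL₀ hL₁ hc₀ hc₁,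
    fun h => Subcomplex.exists_isEigensystem (hM₀ h) (hM₁ h) (hd₀ h) (hd₁ h), ?_⟩
  rintro N ev v hv j μ ⟨⟨i₀, hi₀, rfl⟩, -⟩
  have hμ : 0 < ev i₀ := inv_pos.1 ((hv.isSpectralSystem hL₀ hL₁).pos i₀ hi₀)
  obtain ⟨m, hset, hmN, hρ, hgap⟩ := hv.exists_spectral_gap hL₀ hL₁ hK hμ
  refine ⟨m, ?_, fun ε hε => ?_⟩
  · rw [hset, ← Finset.coe_Iio, Set.encard_coe_eq_coe_finsetCard, Nat.card_Iio]
  rw [← eventually_comap_nhdsGT_zero_iff hS]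
  obtain ⟨g, hg⟩ : ∃ g, IsSpectralSystem.extend N (fun i => (ev i)⁻¹) m + 2 * g = (ev i₀)⁻¹ :=
    ⟨((ev i₀)⁻¹ - IsSpectralSystem.extend N (fun i => (ev i)⁻¹) m) / 2, by ring⟩
  have hgpos : 0 < g := by linarith
  -- The summand 1 absorbs δ ≤ 1, so that `A` also bounds the discrete operators.
  set A := max ‖hodgeSolution L₀ L₁‖ ‖L₁.adjoint‖ + 1 with hA
  obtain ⟨δ, hδ, hδ1, hδg, hδε, hδε'⟩ : ∃ δ > 0, δ ≤ 1 ∧ δ ≤ g ∧ (g ^ 2)⁻¹ * δ ≤ ε ∧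
      m * (2 * g⁻¹ * (δ + A * (δ / g))) ≤ ε := by
    have t₁ : Tendsto (fun δ : ℝ => (g ^ 2)⁻¹ * δ) (𝓝[>] 0) (𝓝 0) := by
      have : Continuous fun δ : ℝ => (g ^ 2)⁻¹ * δ := by fun_prop
      simpa using (this.tendsto 0).mono_left nhdsWithin_le_nhds
    have t₂ : Tendsto (fun δ : ℝ => m * (2 * g⁻¹ * (δ + A * (δ / g)))) (𝓝[>] 0) (𝓝 0) := by
      have : Continuous fun δ : ℝ => m * (2 * g⁻¹ * (δ + A * (δ / g))) := by fun_prop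
      simpa using (this.tendsto 0).mono_left nhdsWithin_le_nhds
    have hev : ∀ᶠ δ : ℝ in 𝓝[>] 0, 0 < δ := eventually_mem_nhdsWithin
    have hsmall : ∀ c > 0, ∀ᶠ δ : ℝ in 𝓝[>] 0, δ ≤ c := fun c hc =>
      eventually_nhdsWithin_of_eventually_nhds (eventually_le_nhds hc)
    obtain ⟨δ, h1, h2, h3, h4, h5⟩ := (hev.and ((hsmall 1 one_pos).and ((hsmall g hgpos).and
      ((t₁.eventually_le_const hε).and (t₂.eventually_le_const hε))))).exists
    exact ⟨δ, h1, h2, h3, h4, h5⟩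
  filter_upwards [hlimK.eventually_le_const hδ, hlimT.eventually_le_const hδ] with h hKh hTh
  intro Nh evh vh hvh
  obtain ⟨h1, h2, h3, h4⟩ := eigenvalues_and_gaps_le hL₀ hL₁ (hM₀ h) (hM₁ h) hK
    (isCompactNonneg_hodgeSolution (hd₀ h) (hd₁ h)) hv hvh hmN hgpos hρ hg.le hδg hKh hTh
    (A := A) (by linarith [le_max_left ‖hodgeSolution L₀ L₁‖ ‖L₁.adjoint‖])
    (by linarith [le_max_right ‖hodgeSolution L₀ L₁‖ ‖L₁.adjoint‖])
  exact ⟨h1, fun i hi => (h2 i hi).trans hδε, h3.trans hδε', h4.trans hδε'⟩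

end HilbertComplex

theorem theorem3p13 {W : ℤ → Type*} [∀ k, NormedAddCommGroup (W k)]
    [∀ k, InnerProductSpace ℝ (W k)] [∀ k, CompleteSpace (W k)]
    (C : HilbertComplex W) (hclosed : C.IsClosedComplex) (hcompact : C.CompactnessProperty)
    (S : Set ℝ) (hS : ∀ h ∈ S, 0 < h) (U : S → C.Subcomplex)
    (hfin : ∀ h k, FiniteDimensional ℝ ((U h).space k))
    (happrox : C.Approximating U)
    (hproj : C.HasUniformlyBoundedCochainProjections U) :
    ∀ k : ℤ, C.EigenvalueProblemsConverge U k :=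
  HilbertComplex.eigenvalueProblemsConverge hclosed hcompact hS U hfin happrox hproj
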